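/- Let $d\ge 5$ and let $\mu$ be a probability distribution on $\mathbb N=\{0,1,2,\dots\}$ with mean $1$, positive finite variance, and a finite exponential moment, i.e. $\sum_{i\ge 0}e^{\lambda i}\mu(i)<\infty$ for some $\lambda>0$. Let $\mathcal T$ be the random infinite ordered rooted tree defined as follows. The root is special and has $i$ children with probability $\mu(i-1)$, $i\ge 1$; its first child is special and its other children are normal. All vertices reproduce independently: normal vertices have offspring law $\mu$ and only normal children; special vertices other than the root have offspring law $\mu_{\rm sb}(i)=i\mu(i)$, and exactly one of their children, chosen uniformly, is special, the others being normal. The special vertices form the spine. The past $\mathcal T_-$ of $\mathcal T$ consists of the spine vertices other than the root, together with all children of spine vertices that come before the special child in the order of the siblings, and all descendants of these children. Given $\mathcal T$ and $x\in\mathbb Z^d$, let $(S^x_u)_{u\in\mathcal T}$ be the random walk indexed by $\mathcal T$ started from $x$: $S^x_\emptyset=x$ at the root $\emptyset$, and the increments along the edges of $\mathcal T$ are independent and uniform on the $2d$ nearest neighbours of the origin. For finite $\Lambda\subset\mathbb Z^d$ put $$\ell_{\mathcal T^x}(\Lambda)=\sum_{y\in\Lambda}\sum_{u\in\mathcal T}\mathbf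 1(S^x_u=y),\qquad G(x,y)=\mathbb E\Big[\sum_{u\in\mathcal T_-}\mathbf 1(S^x_u=y)\Big],\qquad G(x,\Lambda)=\sum_{y\in\Lambda}G(x,y).$$ Then there exists a constant $c>0$ (depending only on $d$ and $\mu$) such that for every $t>0$ and every finite nonempty $\Lambda\subset\mathbb Z^d$, one has $0<\sup_{x\in\mathbb Z^d}G(x,\Lambda)<\infty$ and $$\mathbb P\big(\ell_{\mathcal T^0}(\Lambda)>t\big)\le 2\exp\Big(-c\cdot\frac{t}{\sup_{x\in\mathbb Z^d}G(x,\Lambda)}\Big).$$ -/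

import Mathlib

open MeasureTheory
open scoped ENNReal

noncomputable section

namespace BRW

/-! ### Offspring distributions -/

/-- An offspring distribution with mean `1` and positive, finite variance. -/
structure IsCriticalOffspring (μ : PMF ℕ) : Prop where
  mean_eq_one : ∑' i : ℕ, (i : ℝ≥0∞) * μ i = 1
  variance_pos : 0 < ∑' i : ℕ, ENNReal.ofReal (((i : ℝ) - 1) ^ 2) * μ i
  variance_finite : ∑' i : ℕ, ENNReal.ofReal (((i : ℝ) - 1) ^ 2) * μ i < ∞

/-- `μ` has a finite exponential moment: `∑ i, exp (l i) μ(i) < ∞` for some `l > 0`. -/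
def HasExponentialMoment (μ : PMF ℕ) : Prop :=
  ∃ l : ℝ, 0 < l ∧ ∑' i : ℕ, ENNReal.ofReal (Real.exp (l * i)) * μ i < ∞

/-- The size-biased distribution `i ↦ i μ(i)`. -/
def sizeBiased (μ : PMF ℕ) (hμ : IsCriticalOffspring μ) : PMF ℕ :=
  ⟨fun i => (i : ℝ≥0∞) * μ i, ENNReal.summable.hasSum_iff.2 hμ.mean_eq_one⟩

theorem range_nonempty_of_mem_support {μ : PMF ℕ} {hμ : IsCriticalOffspring μ} {i : ℕ}
    (hi : i ∈ (sizeBiased μ hμ).support) : (Finset.range i).Nonempty := by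
  rw [Finset.nonempty_range_iff]
  rintro rfl
  rw [PMF.mem_support_iff] at hi
  exact hi (show ((0 : ℕ) : ℝ≥0∞) * μ 0 = 0 by simp)

/-- Law of the pair (number of children, index of the special child) for a special vertex other
than the root: the number of children is size-biased and, given that number, the special child is
uniform among the children. Children are indexed from `0`. -/
def specialLaw (μ : PMF ℕ) (hμ : IsCriticalOffspring μ) : PMF (ℕ × ℕ) :=
  (sizeBiased μ hμ).bindOnSupport fun i hi =>
    (PMF.uniformOfFinset (Finset.range i) (range_nonempty_of_mem_support hi)).map fun j => (i, j)

/-- Law of the same pair for the root: `i` children with probability `μ(i - 1)`, `i ≥ 1`, the first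
child being the special one. -/
def rootLaw (μ : PMF ℕ) : PMF (ℕ × ℕ) :=
  μ.map fun i => (i + 1, 0)

/-- Law of (number of children, index of the special child) at height `n` of the spine. -/
def spineLaw (μ : PMF ℕ) (hμ : IsCriticalOffspring μ) : ℕ → PMF (ℕ × ℕ)
  | 0 => rootLaw μ
  | _ + 1 => specialLaw μ hμ

/-! ### The increments -/

/-- The `2d` nearest neighbours of the origin in `ℤ^d`. -/
def nearestNeighbours (d : ℕ) : Finset (Fin d → ℤ) :=
  (Finset.univ.image fun i : Fin d => (Pi.single i 1 : Fin d → ℤ)) ∪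
    Finset.univ.image fun i : Fin d => (Pi.single i (-1) : Fin d → ℤ)

theorem nearestNeighbours_nonempty (d : ℕ) [NeZero d] : (nearestNeighbours d).Nonempty :=
  ⟨Pi.single 0 1, Finset.mem_union_left _ (Finset.mem_image_of_mem _ (Finset.mem_univ _))⟩

/-- The uniform law on the nearest neighbours of the origin. -/
def stepLaw (d : ℕ) [NeZero d] : PMF (Fin d → ℤ) :=
  PMF.uniformOfFinset (nearestNeighbours d) (nearestNeighbours_nonempty d)

/-! ### The infinite tree and the walk indexed by it

Vertices are words of child indices, written from the vertex up to the root: the root is `[]`, the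
`k`-th child of `u` is `k :: u`, and `v` is an ancestor of `u` (or `u` itself) iff `v <:+ u`. -/

/-- All the randomness. For `ω : Sample d`,
* `ω.1 u` is the number of children of `u` if `u` is a normal vertex of the tree;
* `ω.2.1 n` is the number of children of the spine vertex at height `n`, together with the index of
  its special child;
* `ω.2.2 u` is the increment of the walk along the edge from the parent of `u` to `u`. -/
abbrev Sample (d : ℕ) : Type :=
  (List ℕ → ℕ) × (ℕ → ℕ × ℕ) × (List ℕ → Fin d → ℤ)

/-- The law of the sample: all coordinates are independent, with the laws described above. -/
def law (d : ℕ) [NeZero d] (μ : PMF ℕ) (hμ : IsCriticalOffspring μ) : Measure (Sample d) :=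
  (Measure.infinitePi fun _ : List ℕ => μ.toMeasure).prod
    ((Measure.infinitePi fun n : ℕ => (spineLaw μ hμ n).toMeasure).prod
      (Measure.infinitePi fun _ : List ℕ => (stepLaw d).toMeasure))

variable {d : ℕ}

/-- The spine vertex at height `n`. -/
def spine (ω : Sample d) : ℕ → List ℕ
  | 0 => []
  | n + 1 => (ω.2.1 n).2 :: spine ω n

/-- Number of children of `u`. -/
def numChildren (ω : Sample d) (u : List ℕ) : ℕ :=
  if u = spine ω u.length then (ω.2.1 u.length).1 else ω.1 u

/-- `u` is a vertex of the infinite tree. -/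
def IsVertex (ω : Sample d) : List ℕ → Prop
  | [] => True
  | k :: u => IsVertex ω u ∧ k < numChildren ω u

/-- The infinite tree. -/
def tree (ω : Sample d) : Set (List ℕ) :=
  {u | IsVertex ω u}

/-- The past of the infinite tree: the spine vertices other than the root, and the vertices
that are equal to or descend from a child of a spine vertex that comes before the special child.
(No child of the root comes before its special child.) -/
def past (ω : Sample d) : Set (List ℕ) :=
  {u | u ∈ tree ω ∧
    ((∃ n, u = spine ω (n + 1)) ∨ ∃ n, ∃ k < (ω.2.1 n).2, (k :: spine ω n) <:+ u)}

/-- The walk indexed by the tree, started from `x`. -/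
def walk (ω : Sample d) (x : Fin d → ℤ) : List ℕ → Fin d → ℤ
  | [] => x
  | k :: u => walk ω x u + ω.2.2 (k :: u)

/-- The number of vertices in the set `A` of vertices at which the walk started from `x` is
at `y`. -/
def visits (ω : Sample d) (A : Set (List ℕ)) (x y : Fin d → ℤ) : ℝ≥0∞ :=
  ∑' u : List ℕ, {u | u ∈ A ∧ walk ω x u = y}.indicator 1 u

/-- The total time spent in `Λ` by the walk indexed by the infinite tree, started from `x`. -/
def localTime (ω : Sample d) (x : Fin d → ℤ) (Λ : Finset (Fin d → ℤ)) : ℝ≥0∞ :=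
  ∑ y ∈ Λ, visits ω (tree ω) x y

/-- The Green's function `G(x, y)`: expected number of visits to `y` of the walk indexed by the
past of the infinite tree, started from `x`. -/
def green (d : ℕ) [NeZero d] (μ : PMF ℕ) (hμ : IsCriticalOffspring μ) (x y : Fin d → ℤ) : ℝ≥0∞ :=
  ∫⁻ ω, visits ω (past ω) x y ∂(law d μ hμ)

/-- `G(x, Λ) = ∑_{y ∈ Λ} G(x, y)`. -/
def greenSet (d : ℕ) [NeZero d] (μ : PMF ℕ) (hμ : IsCriticalOffspring μ) (x : Fin d → ℤ)
    (Λ : Finset (Fin d → ℤ)) : ℝ≥0∞ :=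
  ∑ y ∈ Λ, green d μ hμ x y

end BRW

end

/-!
The argument compares the Green operator of the simple random walk with one explicit kernel, and
then controls exponential moments by explicit supersolutions.

Write `P` for the transition operator of the simple random walk and `G = ∑ₙ Pⁿ`. For large `A` the
kernel `a x = (A + |x|²)^(-(d - 2) / 2)` is strictly superharmonic, and its charge `b = a - P a` is
summable (`exists_realKernel_superharmonic`, `exists_isGreenKernel`). By the minimality of
potentials, `G f ≤ (b 0)⁻¹ (a ⋆ f)`; since `a` is square summable when `d ≥ 5`, it has no harmonic
part, so `a = G b` (`IsGreenKernel.eq_potential`). Thus `a` serves as the Green's function of the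
walk, and no asymptotics of the latter is needed.

Let `K` be the supremum of `a ⋆ a ⋆ 1_Λ`. The quasi-metric inequality
`a(x - y) a(y - z) ≤ D a(x - z) (a(x - y) + a(y - z))` gives
`G ((a ⋆ 1_Λ)²) ≤ C K (a ⋆ 1_Λ)` (`IsGreenKernel.potential_sq_le`). This absorbs the quadratic term
of the recursion for the exponential moments of a critical branching random walk, whose generating
function is tangent to the identity to first order (`exists_generating_bounds`): for `θ ≤ ε / K`
there are bounded supersolutions `1 + φ` for a normal vertex and `1 + ψ` for a spine vertex
(`exists_supersolution`). By independence of the subtrees of different children, these bound the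
exponential moments of the time spent in `Λ` up to any generation (`lintegral_pow_count_le`), so
that `E exp (θ ℓ(Λ)) ≤ 2`, and Markov's inequality yields a tail bound with `K` in place of
`sup_x G(x, Λ)` (`law_localTime_gt_le`).

It remains to see that `K ≤ C sup_x G(x, Λ)` (`exists_iSup_conv_le_mul`). From `a = G b` follows
`a ⋆ a ⋆ 1_Λ = b ⋆ b ⋆ G² 1_Λ`, hence `K ≤ (∑ b)² sup G² 1_Λ`. A spine vertex has with positive
probability a child that comes before the special one, and a critical tree carries in expectation
the occupation of a single walk, so `G(x, Λ) ≥ β P² G² 1_Λ (x)` with `β > 0` (`le_greenSet`). The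
two steps of `P` are harmless, since the walk can step back and forth.
-/

noncomputable section

namespace BRW

variable {d : ℕ}

/-! ### A strictly superharmonic kernel on the lattice -/

/-- Taylor expansions of `t ↦ t ^ (-s)` at `1`: the odd terms of the symmetric sum cancel, so its
error is of fourth order. -/
theorem exists_rpow_taylor (s : ℝ) : ∃ δ : ℝ, 0 < δ ∧ δ < 1 ∧ ∃ C : ℝ, 0 ≤ C ∧ ∀ t : ℝ, |t| ≤ δ →
    |(1 + t) ^ (-s) + (1 - t) ^ (-s) - 2 - s * (s + 1) * t ^ 2| ≤ C * t ^ 4 ∧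
    |(1 - t) ^ (-s) - 1 - s * t| ≤ C * t ^ 2 := by
  have h := (Real.one_add_rpow_hasFPowerSeriesAt_zero (a := -s))
  obtain ⟨C4, h4⟩ := (h.isBigO_sub_partialSum_pow 4).bound
  obtain ⟨C2, h2⟩ := (h.isBigO_sub_partialSum_pow 2).bound
  obtain ⟨δ, hδ, hball⟩ := Metric.eventually_nhds_iff.1 (h4.and h2)
  have hch : Ring.choose (-s) 2 = s * (s + 1) / 2 := by
    have := Ring.descPochhammer_eq_factorial_smul_choose (-s) 2
    rw [descPochhammer_succ_right, descPochhammer_one] at this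
    simp [Polynomial.smeval_mul, Polynomial.smeval_sub, Nat.factorial] at this
    linarith
  refine ⟨min (δ / 2) (1 / 2), by positivity,
    (min_le_right _ _).trans_lt (by norm_num), max (2 * C4) (max C2 0), by simp, fun t ht => ?_⟩
  have hlt : |t| < δ := (ht.trans (min_le_left _ _)).trans_lt (by linarith)
  have hp := hball (y := t) (by simpa using hlt)
  have hm := hball (y := -t) (by simpa using hlt)
  simp [FormalMultilinearSeries.partialSum, Finset.sum_range_succ, binomialSeries, hch] at hp hm
  constructor
  · have h1 := abs_le.1 hp.1
    have h2 := abs_le.1 hm.1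
    have h4 : |t| ^ 4 = t ^ 4 := by rw [← abs_pow, abs_of_nonneg (by positivity)]
    rw [h4] at h1 h2
    have h5 : 2 * C4 * t ^ 4 ≤ max (2 * C4) (max C2 0) * t ^ 4 := by
      gcongr; exact le_max_left _ _
    rw [show (1 - t) = 1 + -t by ring, abs_le]
    constructor <;> nlinarith
  · have h5 : C2 * t ^ 2 ≤ max (2 * C4) (max C2 0) * t ^ 2 := by
      gcongr; exact (le_max_left _ _).trans (le_max_right _ _)
    have h2 := hm.2
    rw [show (1 - t) = 1 + -t by ring]
    refine le_trans (le_of_eq ?_) (h2.trans h5)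
    congr 1; ring

/-- The squared Euclidean norm of a lattice point. -/
def sqNorm (x : Fin d → ℤ) : ℝ := ∑ i, (x i : ℝ) ^ 2

theorem sqNorm_nonneg (x : Fin d → ℤ) : 0 ≤ sqNorm x :=
  Finset.sum_nonneg fun _ _ => sq_nonneg _

theorem sqNorm_neg (x : Fin d → ℤ) : sqNorm (-x) = sqNorm x := by
  simp [sqNorm]

theorem sq_le_sqNorm (x : Fin d → ℤ) (i : Fin d) : (x i : ℝ) ^ 2 ≤ sqNorm x :=
  Finset.single_le_sum (f := fun i => (x i : ℝ) ^ 2) (fun _ _ => sq_nonneg _) (Finset.mem_univ i)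

theorem sqNorm_add_le (x y : Fin d → ℤ) : sqNorm (x + y) ≤ 2 * sqNorm x + 2 * sqNorm y := by
  simp only [sqNorm, Finset.mul_sum, ← Finset.sum_add_distrib]
  refine Finset.sum_le_sum fun i _ => ?_
  simp only [Pi.add_apply, Int.cast_add]
  nlinarith [sq_nonneg ((x i : ℝ) - y i)]

theorem sqNorm_add_single (x : Fin d → ℤ) (i : Fin d) (e : ℤ) :
    sqNorm (x + Pi.single i e) = sqNorm x + 2 * e * x i + e ^ 2 := by
  have h : ∀ j, ((x + Pi.single i e : Fin d → ℤ) j : ℝ) ^ 2 =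
      (x j : ℝ) ^ 2 + if j = i then 2 * (e : ℝ) * x i + (e : ℝ) ^ 2 else 0 := by
    intro j
    by_cases hj : j = i
    · subst hj; simp; ring
    · simp [hj]
  simp only [sqNorm, h, Finset.sum_add_distrib]
  simp
  ring

/-- The kernel `(A + |x|²)^(-s)`. -/
def realKernel (A s : ℝ) (x : Fin d → ℤ) : ℝ := (A + sqNorm x) ^ (-s)

/-- For the critical exponent `s = (d - 2) / 2` the second order terms in the Taylor expansion of
the discrete Laplacian cancel up to `2 d s (A + 1) (A + 1 + |x|²)^(-s-2)`, and the fourth order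
terms are bounded by a multiple of `(A + 1 + |x|²)^(-s-2)` that does not depend on `A`. Hence the
kernel is strictly superharmonic once `A` is large. -/
theorem exists_realKernel_superharmonic {s : ℝ} (hs : 0 < s) (hd : 2 * (s + 1) = d) :
    ∃ A : ℝ, 1 ≤ A ∧ ∃ C : ℝ, 0 < C ∧ ∀ x : Fin d → ℤ,
      ∑ i, (realKernel A s (x + Pi.single i 1) + realKernel A s (x + Pi.single i (-1))) <
        2 * d * realKernel A s x ∧
      2 * d * realKernel A s x -
        ∑ i, (realKernel A s (x + Pi.single i 1) + realKernel A s (x + Pi.single i (-1))) ≤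
        C * realKernel A (s + 2) x := by
  obtain ⟨δ, hδ, hδ1, C, hC, hT⟩ := exists_rpow_taylor s
  have hd0 : (0 : ℝ) < d := by linarith
  obtain ⟨A, hA1, hAδ, hAC⟩ : ∃ A : ℝ, 1 ≤ A ∧ 4 / δ ^ 2 ≤ A ∧
      2 * d * C + 16 * C ≤ 2 * d * s * A := by
    have h1 : 0 ≤ 4 / δ ^ 2 := by positivity
    have h2 : 0 ≤ (2 * d * C + 16 * C) / (2 * d * s) := by positivity
    refine ⟨1 + 4 / δ ^ 2 + (2 * d * C + 16 * C) / (2 * d * s), by linarith, by linarith, ?_⟩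
    have : (2 * d * C + 16 * C) / (2 * d * s) ≤
        1 + 4 / δ ^ 2 + (2 * d * C + 16 * C) / (2 * d * s) := by linarith
    rw [div_le_iff₀ (by positivity)] at this
    linarith
  refine ⟨A, hA1, 2 * (2 * d * s * (A + 1)), by positivity, fun x => ?_⟩
  obtain ⟨ρ, hρ⟩ : ∃ ρ, ρ = A + sqNorm x := ⟨_, rfl⟩
  have hx0 := sqNorm_nonneg x
  have hρ1 : 1 ≤ ρ := by linarith
  obtain ⟨u, hu⟩ : ∃ u, u = 1 / (ρ + 1) := ⟨_, rfl⟩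
  have hu0 : 0 < u := by rw [hu]; positivity
  have huσ : u * (ρ + 1) = 1 := by rw [hu]; field_simp
  have huA : u * (A + 1 + sqNorm x) = 1 := by linear_combination huσ - u * hρ
  have hu4 : 4 * u ≤ δ ^ 2 := by
    rw [div_le_iff₀ (by positivity)] at hAδ
    have : u * A ≤ 1 := by nlinarith
    nlinarith [sq_nonneg δ]
  have hu1 : u ≤ δ := by nlinarith
  have hxu : sqNorm x * u ≤ 1 := by nlinarith
  have ht : ∀ i, (2 * x i * u) ^ 2 ≤ 4 * u := fun i => by
    have h1 := sq_le_sqNorm x i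
    have : (x i : ℝ) ^ 2 * u ≤ 1 := le_trans (by gcongr) hxu
    nlinarith
  have htδ : ∀ i, |2 * x i * u| ≤ δ := fun i =>
    abs_le_of_sq_le_sq ((ht i).trans hu4) hδ.le
  -- The error terms in the expansions of the neighbouring values and of the central value.
  obtain ⟨E, hE⟩ : ∃ E : Fin d → ℝ, ∀ i, E i = (1 + 2 * x i * u) ^ (-s) +
    (1 - 2 * x i * u) ^ (-s) - 2 - s * (s + 1) * (2 * x i * u) ^ 2 := ⟨_, fun _ => rfl⟩
  obtain ⟨F, hF⟩ : ∃ F, F = (1 - u) ^ (-s) - 1 - s * u := ⟨_, rfl⟩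
  have hFb : |F| ≤ C * u ^ 2 := hF ▸ (hT u (by rwa [abs_of_pos hu0])).2
  have hEb : |∑ i, E i| ≤ 16 * C * u ^ 2 := by
    calc |∑ i, E i| ≤ ∑ i, |E i| := Finset.abs_sum_le_sum_abs _ _
      _ ≤ ∑ i, C * (16 * u ^ 3 * (x i : ℝ) ^ 2) := by
          refine Finset.sum_le_sum fun i _ => (hE i ▸ (hT _ (htδ i)).1).trans ?_
          refine mul_le_mul_of_nonneg_left ?_ hC
          calc (2 * x i * u) ^ 4 = (2 * x i * u) ^ 2 * (2 * x i * u) ^ 2 := by ring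
            _ ≤ 4 * u * (2 * x i * u) ^ 2 := by gcongr; exact ht i
            _ = _ := by ring
      _ = C * 16 * u ^ 2 * (sqNorm x * u) := by
          simp only [sqNorm, Finset.sum_mul, Finset.mul_sum]
          refine Finset.sum_congr rfl fun i _ => by ring
      _ ≤ C * 16 * u ^ 2 * 1 := by gcongr
      _ = _ := by ring
  have hσ : 0 < ρ + 1 := by linarith
  have hval : ∀ i, realKernel A s (x + Pi.single i 1) + realKernel A s (x + Pi.single i (-1)) =
      (ρ + 1) ^ (-s) * (2 + s * (s + 1) * (2 * x i * u) ^ 2 + E i) := by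
    intro i
    have hti := abs_le.1 (htδ i)
    have h1 : realKernel A s (x + Pi.single i 1) = (ρ + 1) ^ (-s) * (1 + 2 * x i * u) ^ (-s) := by
      rw [realKernel, ← Real.mul_rpow hσ.le (by linarith), sqNorm_add_single]
      congr 1
      push_cast
      linear_combination (-2 * (x i : ℝ)) * huσ - hρ
    have h2 : realKernel A s (x + Pi.single i (-1)) =
        (ρ + 1) ^ (-s) * (1 - 2 * x i * u) ^ (-s) := by
      rw [realKernel, ← Real.mul_rpow hσ.le (by linarith), sqNorm_add_single]
      congr 1
      push_cast
      linear_combination (2 * (x i : ℝ)) * huσ - hρ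
    rw [h1, h2, hE]; ring
  have hcen : realKernel A s x = (ρ + 1) ^ (-s) * (1 + s * u + F) := by
    have : realKernel A s x = (ρ + 1) ^ (-s) * (1 - u) ^ (-s) := by
      rw [realKernel, ← Real.mul_rpow hσ.le (by linarith)]
      congr 1
      linear_combination huσ - hρ
    rw [this, hF]; ring
  have hdiff : 2 * d * realKernel A s x -
      ∑ i, (realKernel A s (x + Pi.single i 1) + realKernel A s (x + Pi.single i (-1))) =
      (ρ + 1) ^ (-s) * (2 * d * s * (A + 1) * u ^ 2 + (2 * d * F - ∑ i, E i)) := by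
    simp only [hval, hcen, ← Finset.mul_sum, Finset.sum_add_distrib]
    have : ∑ i, (2 * (x i : ℝ) * u) ^ 2 = 4 * u ^ 2 * sqNorm x := by
      simp only [sqNorm, Finset.mul_sum]
      exact Finset.sum_congr rfl fun i _ => by ring
    rw [this]
    simp only [Finset.sum_const, Finset.card_univ, Fintype.card_fin, nsmul_eq_mul]
    rw [← hd]
    linear_combination (-(4 * (s + 1) * s * u) * (ρ + 1) ^ (-s)) * huA
  have herr : |2 * d * F - ∑ i, E i| ≤ (2 * d * C + 16 * C) * u ^ 2 := by
    have h1 := abs_le.1 hFb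
    have h2 := abs_le.1 hEb
    rw [abs_le]
    constructor <;>
      nlinarith [mul_le_mul_of_nonneg_left h1.1 hd0.le, mul_le_mul_of_nonneg_left h1.2 hd0.le]
  have herr' := abs_le.1 herr
  have hu2 : 0 < u ^ 2 := by positivity
  have hσs : 0 < (ρ + 1) ^ (-s) := Real.rpow_pos_of_pos hσ _
  have hle : (2 * d * C + 16 * C) * u ^ 2 ≤ 2 * d * s * A * u ^ 2 := by gcongr
  have hds : 0 < 2 * d * s * u ^ 2 := by positivity
  constructor
  · rw [← sub_pos, hdiff]
    exact mul_pos hσs (by nlinarith)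
  · rw [hdiff]
    have hk : (ρ + 1) ^ (-s) * u ^ 2 ≤ realKernel A (s + 2) x := by
      have h1 : u ^ 2 = (ρ + 1) ^ (-2 : ℝ) := by
        rw [hu, Real.rpow_neg hσ.le, one_div, inv_pow]
        norm_cast
      rw [h1, ← Real.rpow_add hσ, realKernel, show -s + -2 = -(s + 2) by ring]
      exact Real.rpow_le_rpow_of_nonpos (by linarith) (by linarith) (by linarith)
    calc (ρ + 1) ^ (-s) * (2 * d * s * (A + 1) * u ^ 2 + (2 * d * F - ∑ i, E i))
        ≤ (ρ + 1) ^ (-s) * (2 * (2 * d * s * (A + 1)) * u ^ 2) := by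
          refine mul_le_mul_of_nonneg_left ?_ hσs.le; linarith [herr'.2]
      _ = 2 * (2 * d * s * (A + 1)) * ((ρ + 1) ^ (-s) * u ^ 2) := by ring
      _ ≤ _ := by gcongr

theorem summable_pi_prod {w : ℤ → ℝ} (hw0 : ∀ n, 0 ≤ w n) (hw1 : Summable w) :
    Summable fun x : Fin d → ℤ => ∏ i, w (x i) := by
  refine summable_of_sum_le (c := (∑' n, w n) ^ d)
    (fun x => Finset.prod_nonneg fun i _ => hw0 _) fun S => ?_
  classical
  calc ∑ x ∈ S, ∏ i, w (x i)
      ≤ ∑ x ∈ Fintype.piFinset fun i : Fin d => S.image fun x => x i, ∏ i, w (x i) := by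
        refine Finset.sum_le_sum_of_subset_of_nonneg (fun x hx => ?_) fun x _ _ =>
          Finset.prod_nonneg fun i _ => hw0 _
        exact Fintype.mem_piFinset.2 fun i => Finset.mem_image_of_mem _ hx
    _ = ∏ i : Fin d, ∑ n ∈ S.image fun x => x i, w n := (Finset.prod_univ_sum _ _).symm
    _ ≤ ∏ _i : Fin d, ∑' n, w n := Finset.prod_le_prod
        (fun i _ => Finset.sum_nonneg fun _ _ => hw0 _)
        fun i _ => hw1.sum_le_tsum _ fun _ _ => hw0 _
    _ = _ := by simp

theorem summable_one_add_sq_rpow {p : ℝ} (hp : 1 < 2 * p) :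
    Summable fun n : ℤ => (1 + (n : ℝ) ^ 2) ^ (-p) := by
  have h1 : Summable fun n : ℤ => |(n : ℝ)| ^ (-(2 * p)) := Real.summable_abs_int_rpow hp
  refine summable_of_isBigO h1 (Asymptotics.IsBigO.of_bound 1 ?_)
  filter_upwards [(Set.finite_singleton (0 : ℤ)).compl_mem_cofinite] with n hn
  have hn' : 0 < |(n : ℝ)| := by simpa using hn
  rw [Real.norm_of_nonneg (by positivity), Real.norm_of_nonneg (by positivity), one_mul]
  have : |(n : ℝ)| ^ (-(2 * p)) = ((n : ℝ) ^ 2) ^ (-p) := by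
    rw [← sq_abs, ← Real.rpow_natCast, ← Real.rpow_mul hn'.le]
    congr 1; push_cast; ring
  rw [this]
  have hn2 : 0 < (n : ℝ) ^ 2 := by rw [← sq_abs]; positivity
  exact Real.rpow_le_rpow_of_nonpos hn2 (by linarith) (by linarith)

/-- The kernel is bounded by a product of summable functions of the coordinates, since `A + |x|²`
is at least each of the factors `1 + x i ^ 2`. -/
theorem summable_realKernel {A r : ℝ} (hA : 1 ≤ A) (hr : (d : ℝ) < 2 * r) (hd : 0 < d) :
    Summable (realKernel A r : (Fin d → ℤ) → ℝ) := by
  have hd' : (0 : ℝ) < d := by exact_mod_cast hd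
  have hp : 0 < r / d := div_pos (by linarith) hd'
  have hx : ∀ x : Fin d → ℤ, 0 < A + sqNorm x := fun x => by linarith [sqNorm_nonneg x]
  refine Summable.of_nonneg_of_le (fun x => Real.rpow_nonneg (hx x).le _) (fun x => ?_)
    (summable_pi_prod (w := fun n : ℤ => (1 + (n : ℝ) ^ 2) ^ (-(r / d))) (fun n => by positivity)
      (summable_one_add_sq_rpow (p := r / d)
        (by rw [← mul_div_assoc, lt_div_iff₀ hd']; linarith)))
  calc realKernel A r x = ∏ _i : Fin d, (A + sqNorm x) ^ (-(r / d)) := by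
        rw [Finset.prod_const, Finset.card_univ, Fintype.card_fin, ← Real.rpow_natCast,
          ← Real.rpow_mul (hx x).le, realKernel]
        congr 1; field_simp
    _ ≤ _ := Finset.prod_le_prod (fun i _ => (Real.rpow_pos_of_pos (hx x) _).le) fun i _ =>
        Real.rpow_le_rpow_of_nonpos (by positivity) (by linarith [sq_le_sqNorm x i]) (by linarith)

/-- The quasi-metric property of the kernel. -/
theorem realKernel_mul_le {A s : ℝ} (hA : 1 ≤ A) (hs : 0 < s) (x y : Fin d → ℤ) :
    realKernel A s x * realKernel A s y ≤
      4 ^ s * (realKernel A s (x + y) * (realKernel A s x + realKernel A s y)) := by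
  have hx := sqNorm_nonneg x
  have hy := sqNorm_nonneg y
  have hxy := sqNorm_nonneg (x + y)
  have hadd := sqNorm_add_le x y
  have key : ∀ z : Fin d → ℤ, A + sqNorm (x + y) ≤ 4 * (A + sqNorm z) →
      realKernel A s z ≤ 4 ^ s * realKernel A s (x + y) := by
    intro z hz
    have hz0 := sqNorm_nonneg z
    have h1 : (4 * (A + sqNorm z)) ^ (-s) ≤ realKernel A s (x + y) :=
      Real.rpow_le_rpow_of_nonpos (by linarith) hz (by linarith)
    rw [Real.mul_rpow (by norm_num) (by linarith)] at h1
    calc realKernel A s z = 4 ^ s * (4 ^ (-s) * (A + sqNorm z) ^ (-s)) := by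
          rw [← mul_assoc, ← Real.rpow_add (by norm_num)]; simp [realKernel]
      _ ≤ _ := by gcongr
  have hpos : ∀ z : Fin d → ℤ, 0 ≤ realKernel A s z := fun z =>
    Real.rpow_nonneg (by linarith [sqNorm_nonneg z]) _
  have h4 : (0 : ℝ) ≤ 4 ^ s := by positivity
  rcases le_total (sqNorm x) (sqNorm y) with h | h
  · have := mul_le_mul_of_nonneg_right (key y (by linarith)) (hpos x)
    nlinarith [mul_nonneg h4 (mul_nonneg (hpos (x + y)) (hpos y))]
  · have := mul_le_mul_of_nonneg_right (key x (by linarith)) (hpos y)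
    nlinarith [mul_nonneg h4 (mul_nonneg (hpos (x + y)) (hpos x))]

/-! ### Potential theory of the simple random walk -/

theorem sum_nearestNeighbours {M : Type*} [AddCommMonoid M] (f : (Fin d → ℤ) → M) :
    ∑ e ∈ nearestNeighbours d, f e = ∑ i, (f (Pi.single i 1) + f (Pi.single i (-1))) := by
  classical
  rw [nearestNeighbours, Finset.sum_union, Finset.sum_image, Finset.sum_image,
    Finset.sum_add_distrib]
  · intro i _ j _ h
    by_contra hij
    simpa [hij] using congrFun h i
  · intro i _ j _ h
    by_contra hij
    simpa [hij] using congrFun h i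
  · rw [Finset.disjoint_left]
    intro x hx hx'
    simp only [Finset.mem_image, Finset.mem_univ, true_and] at hx hx'
    obtain ⟨i, rfl⟩ := hx
    obtain ⟨j, hj⟩ := hx'
    have := congrFun hj i
    by_cases hij : i = j
    · subst hij; simp at this
    · simp [hij] at this

theorem card_nearestNeighbours (d : ℕ) : (nearestNeighbours d).card = 2 * d := by
  rw [Finset.card_eq_sum_ones, sum_nearestNeighbours]
  simp [mul_comm]

/-- The transition operator of the simple random walk. -/
def avg (φ : (Fin d → ℤ) → ℝ≥0∞) (x : Fin d → ℤ) : ℝ≥0∞ :=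
  ∑ e ∈ nearestNeighbours d, ((nearestNeighbours d).card : ℝ≥0∞)⁻¹ * φ (x + e)

/-- The Green operator `∑ₙ Pⁿ` of the simple random walk. -/
def potential (φ : (Fin d → ℤ) → ℝ≥0∞) (x : Fin d → ℤ) : ℝ≥0∞ :=
  ∑' n, avg^[n] φ x

/-- The convolution of a kernel and a function on the lattice. -/
def conv (k f : (Fin d → ℤ) → ℝ≥0∞) (x : Fin d → ℤ) : ℝ≥0∞ :=
  ∑' y, k (x - y) * f y

theorem avg_mono : Monotone (avg (d := d)) := fun _ _ h _ =>
  Finset.sum_le_sum fun _ _ => by gcongr; exact h _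

theorem iterate_avg_mono (n : ℕ) : Monotone (avg (d := d))^[n] := avg_mono.iterate n

theorem sum_weights (d : ℕ) [NeZero d] :
    ∑ _e ∈ nearestNeighbours d, ((nearestNeighbours d).card : ℝ≥0∞)⁻¹ = 1 := by
  rw [Finset.sum_const, nsmul_eq_mul, ENNReal.mul_inv_cancel]
  · simpa using (nearestNeighbours_nonempty d).ne_empty
  · simp

theorem avg_const [NeZero d] (c : ℝ≥0∞) : avg (fun _ : Fin d → ℤ => c) = fun _ => c := by
  ext x
  rw [avg, ← Finset.sum_mul, sum_weights, one_mul]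

theorem avg_add (φ ψ : (Fin d → ℤ) → ℝ≥0∞) : avg (φ + ψ) = avg φ + avg ψ := by
  ext x
  simp [avg, mul_add, Finset.sum_add_distrib]

theorem avg_smul (c : ℝ≥0∞) (φ : (Fin d → ℤ) → ℝ≥0∞) : avg (c • φ) = c • avg φ := by
  ext x
  simp only [avg, Pi.smul_apply, smul_eq_mul, Finset.mul_sum]
  exact Finset.sum_congr rfl fun _ _ => by ring

theorem avg_tsum {ι : Type*} (φ : ι → (Fin d → ℤ) → ℝ≥0∞) :
    avg (fun x => ∑' i, φ i x) = fun x => ∑' i, avg (φ i) x := by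
  ext x
  simp only [avg, ← ENNReal.tsum_mul_left]
  exact (Summable.tsum_finsetSum fun _ _ => ENNReal.summable).symm

theorem iterate_avg_tsum {ι : Type*} (n : ℕ) : ∀ φ : ι → (Fin d → ℤ) → ℝ≥0∞,
    avg^[n] (fun x => ∑' i, φ i x) = fun x => ∑' i, avg^[n] (φ i) x := by
  induction n with
  | zero => intro φ; rfl
  | succ n ih => intro φ; simp only [Function.iterate_succ_apply, avg_tsum, ih]

theorem iterate_avg_smul (n : ℕ) (c : ℝ≥0∞) (φ : (Fin d → ℤ) → ℝ≥0∞) :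
    avg^[n] (c • φ) = c • avg^[n] φ := by
  induction n generalizing φ with
  | zero => rfl
  | succ n ih => simp only [Function.iterate_succ_apply, avg_smul, ih]

theorem iterate_avg_add (n : ℕ) (φ ψ : (Fin d → ℤ) → ℝ≥0∞) :
    avg^[n] (φ + ψ) = avg^[n] φ + avg^[n] ψ := by
  induction n generalizing φ ψ with
  | zero => rfl
  | succ n ih => simp only [Function.iterate_succ_apply, avg_add, ih]

theorem avg_iSup_of_monotone {φ : ℕ → (Fin d → ℤ) → ℝ≥0∞} (h : Monotone φ) :
    avg (fun x => ⨆ n, φ n x) = fun x => ⨆ n, avg (φ n) x := by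
  ext x
  simp only [avg, ENNReal.mul_iSup]
  exact ENNReal.finsetSum_iSup_of_monotone fun e m n hmn => by gcongr; exact h hmn _

theorem potential_mono : Monotone (potential (d := d)) := fun _ _ h x =>
  ENNReal.tsum_le_tsum fun n => iterate_avg_mono n h x

theorem potential_add (φ ψ : (Fin d → ℤ) → ℝ≥0∞) :
    potential (φ + ψ) = potential φ + potential ψ := by
  ext x
  simp only [potential, iterate_avg_add, Pi.add_apply, ENNReal.tsum_add]

theorem potential_smul (c : ℝ≥0∞) (φ : (Fin d → ℤ) → ℝ≥0∞) :
    potential (c • φ) = c • potential φ := by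
  ext x
  simp only [potential, iterate_avg_smul, Pi.smul_apply, smul_eq_mul, ENNReal.tsum_mul_left]

theorem potential_tsum {ι : Type*} (φ : ι → (Fin d → ℤ) → ℝ≥0∞) :
    potential (fun x => ∑' i, φ i x) = fun x => ∑' i, potential (φ i) x := by
  ext x
  simp only [potential, iterate_avg_tsum]
  exact ENNReal.tsum_comm

theorem potential_eq (φ : (Fin d → ℤ) → ℝ≥0∞) : potential φ = φ + avg (potential φ) := by
  ext x
  have h : avg (potential φ) = fun x => ∑' n, avg (avg^[n] φ) x := avg_tsum _
  simp only [h, ← Function.iterate_succ_apply' avg]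
  rw [potential, tsum_eq_zero_add' ENNReal.summable]
  rfl

theorem avg_potential (φ : (Fin d → ℤ) → ℝ≥0∞) : avg (potential φ) = potential (avg φ) := by
  have h : avg (potential φ) = fun x => ∑' n, avg (avg^[n] φ) x := avg_tsum _
  rw [h]
  ext x
  simp only [potential, ← Function.iterate_succ_apply' avg, ← Function.iterate_succ_apply avg]

theorem eq_sum_add_of_eq {φ ρ : (Fin d → ℤ) → ℝ≥0∞} (h : φ = avg φ + ρ) (N : ℕ)
    (x : Fin d → ℤ) : φ x = avg^[N] φ x + ∑ n ∈ Finset.range N, avg^[n] ρ x := by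
  induction N with
  | zero => simp
  | succ N ih =>
    rw [ih, Finset.sum_range_succ, Function.iterate_succ_apply]
    nth_rewrite 1 [h]
    rw [iterate_avg_add]
    simp only [Pi.add_apply]
    ring

/-- The potential of `ρ` is the least nonnegative solution of `φ ≥ P φ + ρ`. -/
theorem potential_le_of_superharmonic {φ ρ : (Fin d → ℤ) → ℝ≥0∞} (h : avg φ + ρ ≤ φ) :
    potential ρ ≤ φ := by
  have key : ∀ N x, ∑ n ∈ Finset.range N, avg^[n] ρ x + avg^[N] φ x ≤ φ x := by
    intro N x
    induction N with
    | zero => simp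
    | succ N ih =>
      refine le_trans ?_ ih
      rw [Finset.sum_range_succ, add_assoc]
      gcongr
      have := iterate_avg_mono N h x
      rw [iterate_avg_add, Pi.add_apply, ← Function.iterate_succ_apply avg] at this
      rwa [add_comm]
  intro x
  rw [potential, ENNReal.tsum_eq_iSup_nat]
  exact iSup_le fun N => le_self_add.trans (key N x)

/-- Jensen's inequality for the law of the simple random walk after `n` steps. -/
theorem iterate_avg_sq_le [NeZero d] (n : ℕ) (φ : (Fin d → ℤ) → ℝ≥0∞) (x : Fin d → ℤ) :
    (avg^[n] φ x) ^ 2 ≤ avg^[n] (fun y => φ y ^ 2) x := by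
  have h1 : ∀ φ : (Fin d → ℤ) → ℝ≥0∞, (fun y => avg φ y ^ 2) ≤ avg (fun y => φ y ^ 2) := by
    intro φ y
    have := ENNReal.rpow_arith_mean_le_arith_mean_rpow (nearestNeighbours d)
      (fun _ => ((nearestNeighbours d).card : ℝ≥0∞)⁻¹) (fun e => φ (y + e)) (sum_weights d)
      (p := 2) (by norm_num)
    simpa [avg] using this
  induction n generalizing φ with
  | zero => simp
  | succ n ih =>
    simp only [Function.iterate_succ_apply]
    exact (ih _).trans (iterate_avg_mono n (h1 φ) x)

theorem conv_eq_tsum_sub (k f : (Fin d → ℤ) → ℝ≥0∞) (x : Fin d → ℤ) :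
    conv k f x = ∑' y, k y * f (x - y) := by
  rw [conv, ← (Equiv.subLeft x).tsum_eq]
  simp

theorem conv_le_mul (k : (Fin d → ℤ) → ℝ≥0∞) {f : (Fin d → ℤ) → ℝ≥0∞} {m : ℝ≥0∞}
    (h : ∀ x, f x ≤ m) (x : Fin d → ℤ) : conv k f x ≤ (∑' y, k y) * m := by
  rw [conv_eq_tsum_sub, ← ENNReal.tsum_mul_right]
  exact ENNReal.tsum_le_tsum fun _ => by gcongr; exact h _

theorem avg_translate (k : (Fin d → ℤ) → ℝ≥0∞) (y x : Fin d → ℤ) :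
    avg (fun x => k (x - y)) x = avg k (x - y) := by
  simp only [avg]
  exact Finset.sum_congr rfl fun e _ => by rw [sub_add_eq_add_sub]

theorem iterate_avg_translate (n : ℕ) (k : (Fin d → ℤ) → ℝ≥0∞) (y x : Fin d → ℤ) :
    avg^[n] (fun x => k (x - y)) x = avg^[n] k (x - y) := by
  induction n generalizing k with
  | zero => rfl
  | succ n ih =>
    rw [Function.iterate_succ_apply, Function.iterate_succ_apply, ← ih]
    exact congrArg (fun g => avg^[n] g x) (funext fun z => avg_translate k y z)

theorem potential_translate (k : (Fin d → ℤ) → ℝ≥0∞) (y x : Fin d → ℤ) :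
    potential (fun x => k (x - y)) x = potential k (x - y) := by
  simp only [potential, iterate_avg_translate]

theorem potential_conv (k f : (Fin d → ℤ) → ℝ≥0∞) :
    potential (conv k f) = conv (potential k) f := by
  have h : conv k f = fun x => ∑' y, (f y • fun x => k (x - y)) x := by
    ext x; simp [conv, mul_comm]
  rw [h, potential_tsum]
  ext x
  simp only [potential_smul, Pi.smul_apply, smul_eq_mul, potential_translate, conv]
  exact tsum_congr fun y => mul_comm _ _

theorem potential_conv' (k f : (Fin d → ℤ) → ℝ≥0∞) :
    potential (conv k f) = conv k (potential f) := by
  have h : conv k f = fun x => ∑' y, (k y • fun x => f (x - y)) x := by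
    ext x; simp [conv_eq_tsum_sub]
  rw [h, potential_tsum]
  ext x
  simp only [potential_smul, Pi.smul_apply, smul_eq_mul, potential_translate, conv_eq_tsum_sub]

theorem conv_indicator_zero (f : (Fin d → ℤ) → ℝ≥0∞) :
    conv (Set.indicator {0} 1) f = f := by
  ext x
  rw [conv, tsum_eq_single x]
  · simp
  · intro y hy
    have : x - y ≠ 0 := sub_ne_zero.2 hy.symm
    simp [this]

/-- After two steps the simple random walk is back at its starting point with probability at least
the square of the probability of a single step. -/
theorem le_mul_iterate_avg_two (φ : (Fin d → ℤ) → ℝ≥0∞) [NeZero d] (x : Fin d → ℤ) :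
    φ x ≤ ((nearestNeighbours d).card : ℝ≥0∞) ^ 2 * avg^[2] φ x := by
  set N : ℝ≥0∞ := ((nearestNeighbours d).card : ℝ≥0∞) with hN
  have hN0 : N ≠ 0 := by simpa [hN] using (nearestNeighbours_nonempty d).ne_empty
  have hNt : N ≠ ⊤ := by simp [hN]
  have step : ∀ (ψ : (Fin d → ℤ) → ℝ≥0∞) (x e : Fin d → ℤ), e ∈ nearestNeighbours d →
      ψ (x + e) ≤ N * avg ψ x := by
    intro ψ x e he
    calc ψ (x + e) = N * (N⁻¹ * ψ (x + e)) := by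
          rw [← mul_assoc, ENNReal.mul_inv_cancel hN0 hNt, one_mul]
      _ ≤ N * avg ψ x := by
          gcongr
          exact Finset.single_le_sum (f := fun e => N⁻¹ * ψ (x + e)) (fun _ _ => zero_le) he
  have h1 : (Pi.single 0 1 : Fin d → ℤ) ∈ nearestNeighbours d :=
    Finset.mem_union_left _ (Finset.mem_image_of_mem _ (Finset.mem_univ _))
  have h2 : (Pi.single 0 (-1) : Fin d → ℤ) ∈ nearestNeighbours d :=
    Finset.mem_union_right _ (Finset.mem_image_of_mem _ (Finset.mem_univ _))
  calc φ x = φ (x + Pi.single 0 1 + Pi.single 0 (-1)) := by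
        rw [add_assoc, ← Pi.single_add]; simp
    _ ≤ N * avg φ (x + Pi.single 0 1) := step _ _ _ h2
    _ ≤ N * (N * avg (avg φ) x) := by gcongr; exact step _ _ _ h1
    _ = _ := by rw [sq, mul_assoc]; rfl

/-! ### Kernels comparable to the Green's function -/

/-- A superharmonic, even, square summable kernel `a` on the lattice, whose charge `b = a - P a` is
summable and does not vanish at the origin, and which has the quasi-metric property of `|x|^(2-d)`
with constant `D`. -/
structure IsGreenKernel (a b : (Fin d → ℤ) → ℝ≥0∞) (D : ℝ≥0∞) : Prop where
  eq_avg_add : a = avg a + b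
  zero_ne_zero : a 0 ≠ 0
  charge_zero_ne_zero : b 0 ≠ 0
  tsum_charge_ne_top : ∑' x, b x ≠ ⊤
  tsum_sq_ne_top : ∑' x, a x ^ 2 ≠ ⊤
  even : ∀ x, a (-x) = a x
  const_ne_top : D ≠ ⊤
  mul_le : ∀ x y, a x * a y ≤ D * (a (x + y) * (a x + a y))

/-- The kernel `(A + |x|²)^(-(d - 2) / 2)` with `A` large. It is square summable since
`2 (d - 2) > d` for `d ≥ 5`. -/
theorem exists_isGreenKernel (hd : 5 ≤ d) :
    ∃ (a b : (Fin d → ℤ) → ℝ≥0∞) (D : ℝ≥0∞), IsGreenKernel a b D := by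
  have hd5 : (5 : ℝ) ≤ d := by exact_mod_cast hd
  obtain ⟨s, hs, hsd⟩ : ∃ s : ℝ, 0 < s ∧ 2 * (s + 1) = d := ⟨d / 2 - 1, by linarith, by ring⟩
  obtain ⟨A, hA, C, hC, hlap⟩ := exists_realKernel_superharmonic (d := d) hs hsd
  have hpos : ∀ r (x : Fin d → ℤ), 0 < realKernel A r x := fun r x =>
    Real.rpow_pos_of_pos (by linarith [sqNorm_nonneg x]) _
  set L : (Fin d → ℤ) → ℝ := fun x =>
    ∑ i, (realKernel A s (x + Pi.single i 1) + realKernel A s (x + Pi.single i (-1))) with hL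
  have hL0 : ∀ x, 0 ≤ L x := fun x =>
    Finset.sum_nonneg fun i _ => add_nonneg (hpos _ _).le (hpos _ _).le
  have hd0 : (0 : ℝ) < 2 * d := by linarith
  have havg : ∀ x, avg (fun x => ENNReal.ofReal (realKernel A s x)) x =
      ENNReal.ofReal ((2 * d : ℝ)⁻¹ * L x) := by
    intro x
    rw [avg, ← Finset.mul_sum, ENNReal.ofReal_mul (by positivity), card_nearestNeighbours,
      ENNReal.ofReal_inv_of_pos hd0, sum_nearestNeighbours,
      ENNReal.ofReal_sum_of_nonneg fun i _ => add_nonneg (hpos _ _).le (hpos _ _).le]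
    congr 1
    · congr 1
      rw [ENNReal.ofReal_mul (by norm_num)]
      simp
    · exact Finset.sum_congr rfl fun i _ => (ENNReal.ofReal_add (hpos _ _).le (hpos _ _).le).symm
  have hb0 : ∀ x, 0 < realKernel A s x - (2 * d : ℝ)⁻¹ * L x := fun x => by
    rw [sub_pos, inv_mul_lt_iff₀ hd0]
    exact (hlap x).1
  refine ⟨fun x => ENNReal.ofReal (realKernel A s x),
    fun x => ENNReal.ofReal (realKernel A s x - (2 * d : ℝ)⁻¹ * L x), ENNReal.ofReal (4 ^ s),
    ?_, ?_, ?_, ?_, ?_, ?_, ENNReal.ofReal_ne_top, ?_⟩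
  · ext x
    rw [Pi.add_apply, havg, ← ENNReal.ofReal_add (mul_nonneg (by positivity) (hL0 x)) (hb0 x).le]
    congr 1; ring
  · simpa using hpos s 0
  · simpa using hb0 0
  · have hsum : Summable fun x : Fin d → ℤ => (2 * d : ℝ)⁻¹ * (C * realKernel A (s + 2) x) :=
      ((summable_realKernel hA (by linarith) (by omega)).mul_left C).mul_left _
    refine ne_top_of_le_ne_top hsum.tsum_ofReal_ne_top (ENNReal.tsum_le_tsum fun x => ?_)
    refine ENNReal.ofReal_le_ofReal ?_
    rw [le_inv_mul_iff₀ hd0, mul_sub, mul_inv_cancel_left₀ hd0.ne']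
    exact (hlap x).2
  · have hsum : Summable fun x : Fin d → ℤ => realKernel A (2 * s) x :=
      summable_realKernel hA (by linarith) (by omega)
    refine ne_top_of_le_ne_top hsum.tsum_ofReal_ne_top (ENNReal.tsum_le_tsum fun x => ?_)
    rw [← ENNReal.ofReal_pow (hpos _ _).le]
    refine ENNReal.ofReal_le_ofReal (le_of_eq ?_)
    rw [realKernel, realKernel, ← Real.rpow_natCast,
      ← Real.rpow_mul (by linarith [sqNorm_nonneg x])]
    congr 1; push_cast; ring
  · intro x
    simp only [realKernel, sqNorm_neg]
  · intro x y
    rw [← ENNReal.ofReal_add (hpos _ _).le (hpos _ _).le, ← ENNReal.ofReal_mul (hpos _ _).le,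
      ← ENNReal.ofReal_mul (hpos _ _).le, ← ENNReal.ofReal_mul (by positivity)]
    exact ENNReal.ofReal_le_ofReal (realKernel_mul_le hA hs x y)

namespace IsGreenKernel

variable {a b : (Fin d → ℤ) → ℝ≥0∞} {D : ℝ≥0∞}

theorem ne_top (h : IsGreenKernel a b D) (x : Fin d → ℤ) : a x ≠ ⊤ := fun hx =>
  h.tsum_sq_ne_top (ENNReal.tsum_eq_top_of_eq_top ⟨x, by simp [hx]⟩)

theorem conv_conv_self (a f : (Fin d → ℤ) → ℝ≥0∞) (x : Fin d → ℤ) :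
    conv a (conv a f) x = ∑' y, (∑' z, a (x - z) * a (z - y)) * f y := by
  simp only [conv, ← ENNReal.tsum_mul_left, ← ENNReal.tsum_mul_right]
  rw [ENNReal.tsum_comm]
  exact tsum_congr fun y => tsum_congr fun z => (mul_assoc _ _ _).symm

theorem tsum_mul_le (a : (Fin d → ℤ) → ℝ≥0∞) (x y : Fin d → ℤ) :
    ∑' z, a (x - z) * a (z - y) ≤ 2 * ∑' z, a z ^ 2 := by
  have h1 : ∀ p q : ℝ≥0∞, p * q ≤ p ^ 2 + q ^ 2 := fun p q => by
    rcases le_total p q with hpq | hpq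
    · calc p * q ≤ q * q := by gcongr
        _ ≤ _ := by rw [sq q]; exact le_add_self
    · calc p * q ≤ p * p := by gcongr
        _ ≤ _ := by rw [sq p]; exact le_self_add
  calc ∑' z, a (x - z) * a (z - y) ≤ ∑' z, (a (x - z) ^ 2 + a (z - y) ^ 2) :=
        ENNReal.tsum_le_tsum fun z => h1 _ _
    _ = _ := by
        rw [ENNReal.tsum_add, two_mul]
        exact congrArg₂ (· + ·) ((Equiv.subLeft x).tsum_eq fun z => a z ^ 2)
          ((Equiv.subRight y).tsum_eq fun z => a z ^ 2)

/-- The Green operator of the walk is dominated by convolution with the kernel. -/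
theorem potential_le (h : IsGreenKernel a b D) (f : (Fin d → ℤ) → ℝ≥0∞) :
    potential f ≤ (b 0)⁻¹ • conv a f := by
  have hbt : b 0 ≠ ⊤ := ENNReal.ne_top_of_tsum_ne_top h.tsum_charge_ne_top 0
  have h0 : potential (Set.indicator {0} 1 : (Fin d → ℤ) → ℝ≥0∞) ≤ (b 0)⁻¹ • a := by
    refine potential_le_of_superharmonic ?_
    rw [avg_smul]
    nth_rewrite 2 [h.eq_avg_add]
    rw [smul_add]
    gcongr
    intro x
    by_cases hx : x = 0
    · subst hx
      simp [ENNReal.inv_mul_cancel h.charge_zero_ne_zero hbt]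
    · simp [hx]
  calc potential f = conv (potential (Set.indicator {0} 1)) f := by
        rw [← potential_conv, conv_indicator_zero]
    _ ≤ _ := by
        intro x
        rw [Pi.smul_apply, smul_eq_mul, conv, conv, ← ENNReal.tsum_mul_left]
        refine ENNReal.tsum_le_tsum fun y => ?_
        rw [← mul_assoc]
        gcongr
        exact h0 _

/-- The kernel is the potential of its charge: it has no harmonic part, since `(Pⁿ a)²` is at most
`Pⁿ (a²)`, which is summable in `n`. -/
theorem eq_potential [NeZero d] (h : IsGreenKernel a b D) : a = potential b := by
  refine le_antisymm (fun x => ?_) (potential_le_of_superharmonic h.eq_avg_add.ge)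
  have hsum : ∑' n, avg^[n] (fun y => a y ^ 2) x ≠ ⊤ := by
    refine ne_top_of_le_ne_top (b := (b 0)⁻¹ * ∑' y, (1 + ∑' z, a z ^ 2) * a y ^ 2) ?_ ?_
    · rw [ENNReal.tsum_mul_left]
      refine ENNReal.mul_ne_top (ENNReal.inv_ne_top.2 h.charge_zero_ne_zero)
        (ENNReal.mul_ne_top (ENNReal.add_ne_top.2 ⟨ENNReal.one_ne_top, h.tsum_sq_ne_top⟩)
          h.tsum_sq_ne_top)
    · refine (h.potential_le _ x).trans ?_
      rw [Pi.smul_apply, smul_eq_mul, conv]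
      gcongr with y
      have h1 : ∀ p : ℝ≥0∞, p ≤ 1 + p ^ 2 := fun p => by
        rcases le_total p 1 with hp | hp
        · exact hp.trans le_self_add
        · calc p = p * 1 := (mul_one p).symm
            _ ≤ p * p := by gcongr
            _ ≤ 1 + p ^ 2 := by rw [sq]; exact le_add_self
      exact (h1 _).trans (by gcongr; exact ENNReal.le_tsum (f := fun z => a z ^ 2) _)
  have hlim : Filter.Tendsto (fun n => avg^[n] a x) Filter.atTop (nhds 0) := by
    have h1 := ENNReal.tendsto_atTop_zero_of_tsum_ne_top hsum
    have h2 : Filter.Tendsto (fun n => (avg^[n] a x) ^ 2) Filter.atTop (nhds 0) :=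
      tendsto_of_tendsto_of_tendsto_of_le_of_le tendsto_const_nhds h1 (fun _ => zero_le)
        fun n => iterate_avg_sq_le n a x
    have h3 := h2.ennrpow_const (1 / 2 : ℝ)
    rw [ENNReal.zero_rpow_of_pos (by norm_num)] at h3
    refine h3.congr fun n => ?_
    rw [← ENNReal.rpow_natCast, ← ENNReal.rpow_mul]
    norm_num
  refine ge_of_tendsto (x := Filter.atTop) (by simpa using hlim.add_const (potential b x))
    (Filter.Eventually.of_forall fun N => ?_)
  rw [eq_sum_add_of_eq h.eq_avg_add N x]
  gcongr
  exact ENNReal.sum_le_tsum _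

/-- As `a` is the potential of `b`, convolution with `a` is the Green operator followed by
convolution with `b`, which multiplies suprema at most by the total charge. -/
theorem iSup_conv_le [NeZero d] (h : IsGreenKernel a b D)
    (f : (Fin d → ℤ) → ℝ≥0∞) :
    ⨆ x, conv a (conv a f) x ≤ (∑' x, b x) ^ 2 * ⨆ x, potential (potential f) x := by
  have h1 : ∀ f, conv a f = conv b (potential f) := fun f => by
    rw [← potential_conv', potential_conv, ← h.eq_potential]
  refine iSup_le fun x => ?_
  rw [h1 f, h1, potential_conv', sq, mul_assoc]
  exact conv_le_mul _ (conv_le_mul _ (le_iSup (potential (potential f)))) x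

/-- The three kernel inequality in integrated form. -/
theorem potential_sq_le (h : IsGreenKernel a b D) (f : (Fin d → ℤ) → ℝ≥0∞) (x : Fin d → ℤ) :
    potential (fun y => conv a f y ^ 2) x ≤
      (b 0)⁻¹ * D * 2 * (⨆ x, conv a (conv a f) x) * conv a f x := by
  set K := ⨆ x, conv a (conv a f) x
  refine (h.potential_le _ x).trans ?_
  rw [Pi.smul_apply, smul_eq_mul, mul_assoc, mul_assoc, mul_assoc]
  gcongr
  calc conv a (fun y => conv a f y ^ 2) x
      = ∑' y, ∑' z, a (x - y) * a (y - z) * (f z * conv a f y) := by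
        refine tsum_congr fun y => ?_
        change a (x - y) * conv a f y ^ 2 = _
        rw [sq, ← mul_assoc]
        nth_rewrite 1 [conv]
        rw [← ENNReal.tsum_mul_left, ← ENNReal.tsum_mul_right]
        exact tsum_congr fun z => by ring
    _ ≤ ∑' y, ∑' z, D * (a (x - z) * f z * (a (x - y) * conv a f y + a (z - y) * conv a f y)) := by
        refine ENNReal.tsum_le_tsum fun y => ENNReal.tsum_le_tsum fun z => ?_
        have h1 := h.mul_le (x - y) (y - z)
        rw [sub_add_sub_cancel] at h1
        calc _ ≤ D * (a (x - z) * (a (x - y) + a (y - z))) * (f z * conv a f y) := by gcongr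
          _ = _ := by rw [← neg_sub z y, h.even]; ring
    _ = D * ∑' z, a (x - z) * f z * (conv a (conv a f) x + conv a (conv a f) z) := by
        rw [ENNReal.tsum_comm, ← ENNReal.tsum_mul_left]
        refine tsum_congr fun z => ?_
        rw [ENNReal.tsum_mul_left, ENNReal.tsum_mul_left, ENNReal.tsum_add]
        rfl
    _ ≤ D * ∑' z, a (x - z) * f z * (K + K) := by
        gcongr
        · exact le_iSup (conv a (conv a f)) x
        · exact le_iSup (conv a (conv a f)) _
    _ = D * (2 * (K * conv a f x)) := by
        rw [ENNReal.tsum_mul_right, ← two_mul]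
        congr 1
        rw [mul_comm, mul_assoc]
        rfl

theorem conv_le (h : IsGreenKernel a b D) (f : (Fin d → ℤ) → ℝ≥0∞) (x : Fin d → ℤ) :
    conv a f x ≤ (a 0)⁻¹ * ⨆ x, conv a (conv a f) x := by
  rw [← ENNReal.mul_le_iff_le_inv h.zero_ne_zero (h.ne_top 0)]
  refine le_trans ?_ (le_iSup (conv a (conv a f)) x)
  have h1 : a (x - x) * conv a f x ≤ conv a (conv a f) x :=
    ENNReal.le_tsum (f := fun y => a (x - y) * conv a f y) x
  rwa [sub_self] at h1

theorem iSup_conv_ne_top (h : IsGreenKernel a b D) (Λ : Finset (Fin d → ℤ)) :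
    ⨆ x, conv a (conv a (Set.indicator Λ 1)) x ≠ ⊤ := by
  refine ne_top_of_le_ne_top (b := ∑ _y ∈ Λ, 2 * ∑' z, a z ^ 2)
    (ENNReal.sum_ne_top.2 fun _ _ => ENNReal.mul_ne_top (by simp) h.tsum_sq_ne_top)
    (iSup_le fun x => ?_)
  rw [conv_conv_self, tsum_eq_sum (s := Λ)]
  · refine Finset.sum_le_sum fun y hy => ?_
    simpa [hy] using tsum_mul_le a x y
  · intro y hy
    simp [hy]

theorem sq_le_iSup_conv (h : IsGreenKernel a b D) {Λ : Finset (Fin d → ℤ)} (hΛ : Λ.Nonempty) :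
    a 0 ^ 2 ≤ ⨆ x, conv a (conv a (Set.indicator Λ 1)) x := by
  obtain ⟨y, hy⟩ := hΛ
  have h1 := h.conv_le (Set.indicator Λ 1) y
  have h2 := (ENNReal.le_tsum (f := fun z => a (y - z) * Set.indicator (Λ : Set _) 1 z) y).trans h1
  rw [← ENNReal.mul_le_iff_le_inv h.zero_ne_zero (h.ne_top 0)] at h2
  simpa [hy, sq] using h2

end IsGreenKernel

/-! ### Supersolutions of the branching recursions -/

/-- If `θ` is small compared with the inverse of the supremum `K` of `a ⋆ a ⋆ 1_Λ`, then `1 + φ` and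
`1 + ψ` are supersolutions of the recursions satisfied by the exponential moments of the time spent
in `Λ` by the walks indexed by a critical tree and by the infinite tree. Both functions are
potentials. The quadratic term of the first recursion is absorbed since, by the three kernel
inequality, the potential of `(a ⋆ 1_Λ)²` is at most a multiple of `K (a ⋆ 1_Λ)`. -/
theorem exists_supersolution [NeZero d] {a b : (Fin d → ℤ) → ℝ≥0∞} {D A δ : ℝ≥0∞}
    (h : IsGreenKernel a b D) (hA : A ≠ ⊤) (hδ : δ ≠ 0) :
    ∃ ε : ℝ≥0∞, ε ≠ 0 ∧ ε ≠ ⊤ ∧ ∀ Λ : Finset (Fin d → ℤ), Λ.Nonempty → ∀ θ : ℝ≥0∞,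
      θ * (⨆ x, conv a (conv a (Set.indicator Λ 1)) x) ≤ ε →
      θ ≤ 1 ∧ ∃ φ ψ : (Fin d → ℤ) → ℝ≥0∞, (∀ x, avg φ x ≤ δ) ∧ (∀ x, ψ x ≤ 1) ∧
        (∀ x, (1 + 2 * θ * Set.indicator Λ 1 x) * (1 + avg φ x + A * avg φ x ^ 2) ≤ 1 + φ x) ∧
        ∀ x, (1 + 2 * θ * Set.indicator Λ 1 x) * ((1 + A * avg φ x) * (1 + avg ψ x)) ≤
          1 + ψ x := by
  have hbt : b 0 ≠ ⊤ := ENNReal.ne_top_of_tsum_ne_top h.tsum_charge_ne_top 0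
  have hB0 : (b 0)⁻¹ ≠ 0 := ENNReal.inv_ne_zero.2 hbt
  have hBt : (b 0)⁻¹ ≠ ⊤ := ENNReal.inv_ne_top.2 h.charge_zero_ne_zero
  have hat : (a 0)⁻¹ ≠ ⊤ := ENNReal.inv_ne_top.2 h.zero_ne_zero
  have hDt := h.const_ne_top
  generalize hB : (b 0)⁻¹ = B at *
  generalize ha : (a 0)⁻¹ = a' at *
  set c : ℝ≥0∞ := min (min 1 δ) (min (8 * B) (a 0 ^ 2)) with hc
  have hc0 : c ≠ 0 := by
    have := h.zero_ne_zero
    rw [hc, ← pos_iff_ne_zero]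
    exact lt_min (lt_min one_pos hδ.bot_lt)
      (lt_min (mul_ne_zero (by norm_num) hB0).bot_lt (pow_ne_zero _ this).bot_lt)
  set M : ℝ≥0∞ := 1 + A * (16 * B) ^ 2 * (B * D * 2) + 16 * B * a' + A * (16 * B * a') +
    (8 * B * a' + 2 * A * (16 * B) * B) with hM
  have hMt : M ≠ ⊤ := by finiteness
  have hct : c ≠ ⊤ := ne_top_of_le_ne_top ENNReal.one_ne_top
    ((min_le_left _ _).trans (min_le_left _ _))
  have hM0 : M ≠ 0 := by simp [hM]
  refine ⟨c / M, (ENNReal.div_pos hc0 hMt).ne', ENNReal.div_ne_top hct hM0,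
    fun Λ hΛ θ hθ => ?_⟩
  set f : (Fin d → ℤ) → ℝ≥0∞ := Set.indicator Λ 1 with hf
  set K : ℝ≥0∞ := ⨆ x, conv a (conv a f) x with hK
  have hmul : θ * K * M ≤ c := by
    rwa [ENNReal.le_div_iff_mul_le (Or.inl hM0) (Or.inl hMt)] at hθ
  have hsmall : ∀ m : ℝ≥0∞, m ≤ M → m * (θ * K) ≤ c := fun m hm =>
    le_trans (by rw [mul_comm]; gcongr) hmul
  have hc1 : c ≤ 1 := (min_le_left _ _).trans (min_le_left _ _)
  have hcδ : c ≤ δ := (min_le_left _ _).trans (min_le_right _ _)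
  have hcB : c ≤ 8 * B := (min_le_right _ _).trans (min_le_left _ _)
  have hca : c ≤ a 0 ^ 2 := (min_le_right _ _).trans (min_le_right _ _)
  have s1 := hsmall 1 (by simp only [hM, add_assoc]; exact le_self_add)
  have s2 := hsmall (A * (16 * B) ^ 2 * (B * D * 2)) (by
    simp only [hM, add_assoc]; exact le_self_add.trans le_add_self)
  have s3 := hsmall (16 * B * a') (by
    simp only [hM, add_assoc]
    exact le_self_add.trans (le_add_self.trans le_add_self))
  have s4 := hsmall (A * (16 * B * a')) (by
    simp only [hM]; exact le_add_self.trans le_self_add)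
  have s5 := hsmall (8 * B * a' + 2 * A * (16 * B) * B) (by simp only [hM]; exact le_add_self)
  set k := conv a f with hk
  have hkK : ∀ x, k x ≤ a' * K := fun x => ha ▸ h.conv_le f x
  set L : ℝ≥0∞ := 16 * B with hL
  -- The bound `p` for the first supersolution.
  set p : (Fin d → ℤ) → ℝ≥0∞ := fun x => L * θ * k x with hp
  have hpa : ∀ x, p x ≤ L * a' * (θ * K) := fun x => by
    calc p x ≤ L * θ * (a' * K) := by simp only [hp]; gcongr; exact hkK x
      _ = _ := by ring
  have hp1 : ∀ x, p x ≤ 1 := fun x => (hpa x).trans (s3.trans hc1)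
  have hpδ : ∀ x, p x ≤ δ := fun x => (hpa x).trans (s3.trans hcδ)
  have hAp : ∀ x, A * p x ≤ 1 := fun x => by
    calc A * p x ≤ A * (L * a' * (θ * K)) := by gcongr; exact hpa x
      _ = A * (L * a') * (θ * K) := by ring
      _ ≤ 1 := s4.trans hc1
  set φ : (Fin d → ℤ) → ℝ≥0∞ := potential ((8 * θ) • f + (A * (L * θ) ^ 2) • fun y => k y ^ 2)
    with hφ
  have hpf : ∀ x, potential f x ≤ B * k x := fun x => hB ▸ h.potential_le f x
  have hφp : φ ≤ p := by
    intro x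
    rw [hφ, potential_add, potential_smul, potential_smul]
    simp only [Pi.add_apply, Pi.smul_apply, smul_eq_mul]
    calc 8 * θ * potential f x + A * (L * θ) ^ 2 * potential (fun y => k y ^ 2) x
        ≤ 8 * θ * (B * k x) + A * (L * θ) ^ 2 * (B * D * 2 * K * k x) := by
          gcongr
          · exact hpf x
          · exact hB ▸ h.potential_sq_le f x
      _ = 8 * B * (θ * k x) + A * L ^ 2 * (B * D * 2) * (θ * K) * (θ * k x) := by ring
      _ ≤ 8 * B * (θ * k x) + 8 * B * (θ * k x) := by
          gcongr _ + ?_ * _; exact s2.trans hcB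
      _ = p x := by simp only [hp, hL]; ring
  have hφeq : ∀ x, φ x = 8 * θ * f x + A * p x ^ 2 + avg φ x := fun x => by
    have := congrFun (potential_eq ((8 * θ) • f + (A * (L * θ) ^ 2) • fun y => k y ^ 2)) x
    rw [← hφ] at this
    rw [this]
    simp only [Pi.add_apply, Pi.smul_apply, smul_eq_mul, hp]
    ring
  have havgp : ∀ x, avg φ x ≤ p x := fun x =>
    le_trans (by rw [hφeq]; exact le_add_self) (hφp x)
  set ψ : (Fin d → ℤ) → ℝ≥0∞ := potential ((8 * θ) • f + (2 * A * (L * θ)) • k) with hψ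
  have hψ1 : ∀ x, ψ x ≤ 1 := by
    intro x
    rw [hψ, potential_add, potential_smul, potential_smul]
    simp only [Pi.add_apply, Pi.smul_apply, smul_eq_mul]
    calc 8 * θ * potential f x + 2 * A * (L * θ) * potential k x
        ≤ 8 * θ * (B * (a' * K)) + 2 * A * (L * θ) * (B * K) := by
          gcongr
          · exact (hpf x).trans (by gcongr; exact hkK x)
          · refine (h.potential_le k x).trans ?_
            rw [Pi.smul_apply, smul_eq_mul, hB]
            gcongr
            exact le_iSup (conv a k) x
      _ = (8 * B * a' + 2 * A * L * B) * (θ * K) := by ring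
      _ ≤ 1 := s5.trans hc1
  have hψeq : ∀ x, ψ x = 8 * θ * f x + 2 * A * p x + avg ψ x := fun x => by
    have := congrFun (potential_eq ((8 * θ) • f + (2 * A * (L * θ)) • k)) x
    rw [← hψ] at this
    rw [this]
    simp only [Pi.add_apply, Pi.smul_apply, smul_eq_mul, hp]
    ring
  have hψavg : ∀ x, avg ψ x ≤ 1 := fun x =>
    le_trans (by rw [hψeq x]; exact le_add_self) (hψ1 x)
  refine ⟨?_, φ, ψ, fun x => (havgp x).trans (hpδ x), hψ1, fun x => ?_, fun x => ?_⟩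
  · have h1 : θ * a 0 ^ 2 ≤ a 0 ^ 2 := by
      refine le_trans ?_ (s1.trans hca)
      rw [one_mul]
      gcongr
      exact h.sq_le_iSup_conv hΛ
    have h2 : a 0 ^ 2 ≠ 0 := pow_ne_zero _ h.zero_ne_zero
    have h3 : a 0 ^ 2 ≠ ⊤ := ENNReal.pow_ne_top (h.ne_top 0)
    rwa [← ENNReal.le_div_iff_mul_le (Or.inl h2) (Or.inl h3), ENNReal.div_self h2 h3] at h1
  · have h1 : A * avg φ x ^ 2 ≤ 1 := by
      calc A * avg φ x ^ 2 ≤ A * (p x * p x) := by rw [sq]; gcongr <;> exact havgp x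
        _ = A * p x * p x := by ring
        _ ≤ 1 * 1 := by gcongr <;> [exact hAp x; exact hp1 x]
        _ = 1 := one_mul 1
    calc (1 + 2 * θ * f x) * (1 + avg φ x + A * avg φ x ^ 2)
        = 1 + avg φ x + A * avg φ x ^ 2 +
          2 * θ * f x * (1 + avg φ x + A * avg φ x ^ 2) := by ring
      _ ≤ 1 + avg φ x + A * p x ^ 2 + 2 * θ * f x * (1 + 1 + 1 + 1) := by
          gcongr
          · exact havgp x
          · exact le_self_add
          · exact (havgp x).trans (hp1 x)
      _ = 1 + φ x := by rw [hφeq x]; ring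
  · calc (1 + 2 * θ * f x) * ((1 + A * avg φ x) * (1 + avg ψ x))
        ≤ (1 + 2 * θ * f x) * ((1 + A * p x) * (1 + avg ψ x)) := by gcongr; exact havgp x
      _ = 1 + avg ψ x + A * p x * (1 + avg ψ x) +
          2 * θ * f x * ((1 + A * p x) * (1 + avg ψ x)) := by ring
      _ ≤ 1 + avg ψ x + A * p x * (1 + 1) + 2 * θ * f x * ((1 + 1) * (1 + 1)) := by
          gcongr <;> first | exact hψavg x | exact hAp x
      _ = 1 + ψ x := by rw [hψeq x]; ring

/-! ### Offspring laws -/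

theorem one_add_pow_le (s : ℝ≥0∞) (i : ℕ) : (1 + s) ^ i ≤ 1 + s * (i * (1 + s) ^ i) := by
  induction i with
  | zero => simp
  | succ i ih =>
    have h1 : (1 : ℝ≥0∞) ≤ (1 + s) ^ (i + 1) := one_le_pow₀ le_self_add
    calc (1 + s) ^ (i + 1) = (1 + s) ^ i * (1 + s) := pow_succ _ _
      _ ≤ (1 + s * (i * (1 + s) ^ i)) * (1 + s) := by gcongr
      _ = 1 + s * (i * (1 + s) ^ (i + 1)) + s * 1 := by ring
      _ ≤ 1 + s * (i * (1 + s) ^ (i + 1)) + s * (1 + s) ^ (i + 1) := by gcongr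
      _ = _ := by push_cast; ring

theorem one_add_pow_le_sq (s : ℝ≥0∞) (i : ℕ) :
    (1 + s) ^ i ≤ 1 + s * i + s ^ 2 * (i ^ 2 * (1 + s) ^ i) := by
  induction i with
  | zero => simp
  | succ i ih =>
    have h1 : (1 : ℝ≥0∞) ≤ (1 + s) ^ (i + 1) := one_le_pow₀ le_self_add
    calc (1 + s) ^ (i + 1) = (1 + s) ^ i * (1 + s) := pow_succ _ _
      _ ≤ (1 + s * i + s ^ 2 * (i ^ 2 * (1 + s) ^ i)) * (1 + s) := by gcongr
      _ = 1 + s * (i + 1) + s ^ 2 * (i ^ 2 * (1 + s) ^ (i + 1) + i * 1) := by ring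
      _ ≤ 1 + s * (i + 1) + s ^ 2 * (i ^ 2 * (1 + s) ^ (i + 1) +
          (2 * i + 1) * (1 + s) ^ (i + 1)) := by
          gcongr
          calc (i : ℝ≥0∞) ≤ i + (i + 1) := le_self_add
            _ = _ := by ring
      _ = _ := by push_cast; ring

theorem specialLaw_apply (μ : PMF ℕ) (hμ : IsCriticalOffspring μ) (i j : ℕ) :
    specialLaw μ hμ (i, j) = if j < i then μ i else 0 := by
  classical
  have hsb : ∀ i, sizeBiased μ hμ i = (i : ℝ≥0∞) * μ i := fun _ => rfl
  rw [specialLaw, PMF.bindOnSupport_apply, tsum_eq_single i]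
  · split_ifs with h0 hji hji
    · rw [hsb] at h0
      have : μ i = 0 := by
        rcases mul_eq_zero.1 h0 with h | h
        · simp at h; omega
        · exact h
      rw [hsb]; simp [this]
    · simp
    · rw [PMF.map_apply, tsum_eq_single j]
      · have hi : (i : ℝ≥0∞) ≠ 0 := by simp; omega
        simp only [if_true, PMF.uniformOfFinset_apply, Finset.mem_range, hji, Finset.card_range]
        rw [hsb, mul_comm (i : ℝ≥0∞), mul_assoc, ENNReal.mul_inv_cancel hi (by simp), mul_one]
      · intro j' hj'
        simp [hj'.symm]
    · rw [PMF.map_apply, ENNReal.tsum_eq_zero.2, mul_zero]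
      intro j'
      by_cases hj : j = j'
      · subst hj
        simp [PMF.uniformOfFinset_apply, hji]
      · simp [hj]
  · intro i' hi'
    split_ifs with h0
    · simp
    · rw [PMF.map_apply, ENNReal.tsum_eq_zero.2, mul_zero]
      intro j'
      simp [hi'.symm]

theorem tsum_map_mul {α β : Type*} (p : PMF α) (g : α → β) (F : β → ℝ≥0∞) :
    ∑' c, p.map g c * F c = ∑' i, p i * F (g i) := by
  classical
  simp only [PMF.map_apply, ← ENNReal.tsum_mul_right]
  rw [ENNReal.tsum_comm]
  refine tsum_congr fun i => ?_
  rw [tsum_eq_single (g i)]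
  · simp
  · intro c hc
    simp [hc]

theorem tsum_specialLaw_mul (μ : PMF ℕ) (hμ : IsCriticalOffspring μ) (F : ℕ → ℝ≥0∞) :
    ∑' c, specialLaw μ hμ c * F c.1 = ∑' i, i * (μ i * F i) := by
  rw [ENNReal.tsum_prod']
  refine tsum_congr fun i => ?_
  rw [tsum_eq_sum (s := Finset.range i)]
  · rw [Finset.sum_congr rfl (g := fun _ => μ i * F i)]
    · simp
    · intro j hj
      rw [specialLaw_apply, if_pos (Finset.mem_range.1 hj)]
  · intro j hj
    rw [specialLaw_apply, if_neg (by simpa using hj), zero_mul]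

/-- An exponential moment controls the sum of `(i + 1)² (1 + δ)^(i + 1) μ(i)` for small `δ`. The
shift by `1` covers the root, which has one child more than a normal vertex. -/
theorem exists_tsum_sq_mul_pow_ne_top {μ : PMF ℕ} (hexp : HasExponentialMoment μ) :
    ∃ δ : ℝ≥0∞, δ ≠ 0 ∧ δ ≠ ⊤ ∧ ∑' i : ℕ, μ i * ((i + 1) ^ 2 * (1 + δ) ^ (i + 1)) ≠ ⊤ := by
  obtain ⟨l, hl, hlt⟩ := hexp
  refine ⟨ENNReal.ofReal (l / 2), by simpa using hl, ENNReal.ofReal_ne_top, ?_⟩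
  have hb : ∃ C : ℝ, 0 ≤ C ∧ ∀ i : ℕ,
      ((i : ℝ) + 1) ^ 2 * (1 + l / 2) ^ (i + 1) ≤ C * Real.exp (l * i) := by
    refine ⟨2 * (2 / l) ^ 2 * Real.exp l, by positivity, fun i => ?_⟩
    have h1 : (1 + l / 2) ^ (i + 1) ≤ Real.exp (l / 2 * (i + 1)) := by
      calc (1 + l / 2) ^ (i + 1) ≤ Real.exp (l / 2) ^ (i + 1) := by
            gcongr; linarith [Real.add_one_le_exp (l / 2)]
        _ = _ := by rw [← Real.exp_nat_mul]; congr 1; push_cast; ring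
    have h2 : ((i : ℝ) + 1) ^ 2 ≤ 2 * (2 / l) ^ 2 * Real.exp (l / 2 * (i + 1)) := by
      have := Real.quadratic_le_exp_of_nonneg (x := l / 2 * (i + 1)) (by positivity)
      have h3 : ((i : ℝ) + 1) ^ 2 = 2 * (2 / l) ^ 2 * ((l / 2 * (i + 1)) ^ 2 / 2) := by
        field_simp
      rw [h3]
      gcongr
      nlinarith [mul_pos (half_pos hl) (by positivity : (0 : ℝ) < i + 1)]
    calc _ ≤ 2 * (2 / l) ^ 2 * Real.exp (l / 2 * (i + 1)) * Real.exp (l / 2 * (i + 1)) := by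
          gcongr
      _ = 2 * (2 / l) ^ 2 * Real.exp l * Real.exp (l * i) := by
          have : Real.exp (l / 2 * (i + 1)) * Real.exp (l / 2 * (i + 1)) =
              Real.exp l * Real.exp (l * i) := by
            rw [← Real.exp_add, ← Real.exp_add]
            congr 1; ring
          linear_combination (2 * (2 / l) ^ 2) * this
  obtain ⟨C, hC, hb⟩ := hb
  refine ne_top_of_le_ne_top
    (b := ENNReal.ofReal C * ∑' i : ℕ, ENNReal.ofReal (Real.exp (l * i)) * μ i)
    (ENNReal.mul_ne_top ENNReal.ofReal_ne_top hlt.ne) ?_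
  rw [← ENNReal.tsum_mul_left]
  refine ENNReal.tsum_le_tsum fun i => ?_
  rw [mul_comm, ← mul_assoc]
  refine mul_le_mul_left ?_ _
  rw [← ENNReal.ofReal_mul hC]
  refine le_trans (le_of_eq ?_) (ENNReal.ofReal_le_ofReal (hb i))
  rw [ENNReal.ofReal_mul (by positivity), ENNReal.ofReal_pow (by positivity),
    ENNReal.ofReal_pow (by positivity), ENNReal.ofReal_add (by positivity) (by positivity),
    ENNReal.ofReal_add (by positivity) (by positivity)]
  simp

/-- Near `1` the generating function of a critical law with an exponential moment is tangent to the
identity up to a quadratic error, and those of the offspring laws on the spine are bounded by affine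
functions. -/
theorem exists_generating_bounds {μ : PMF ℕ} (hμ : IsCriticalOffspring μ)
    (hexp : HasExponentialMoment μ) :
    ∃ A δ : ℝ≥0∞, A ≠ ⊤ ∧ δ ≠ 0 ∧ ∀ s ≤ δ,
      ∑' i, μ i * (1 + s) ^ i ≤ 1 + s + A * s ^ 2 ∧
      ∀ n, ∑' c, spineLaw μ hμ n c * (1 + s) ^ c.1 ≤ 1 + A * s := by
  obtain ⟨δ, hδ, hδt, hA⟩ := exists_tsum_sq_mul_pow_ne_top hexp
  set A := ∑' i : ℕ, μ i * ((i + 1) ^ 2 * (1 + δ) ^ (i + 1)) with hAdef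
  have hμ1 : ∑' i, μ i = 1 := μ.tsum_coe
  have hmean : ∑' i : ℕ, μ i * i = 1 := by
    rw [← hμ.mean_eq_one]; exact tsum_congr fun i => mul_comm _ _
  have hone : ∀ i : ℕ, (1 : ℝ≥0∞) ≤ i + 1 := fun i => le_add_self
  refine ⟨A, δ, hA, hδ, fun s hs => ?_⟩
  refine ⟨?_, ?_⟩
  · calc ∑' i, μ i * (1 + s) ^ i
        ≤ ∑' i, (μ i + s * (μ i * i) + s ^ 2 * (μ i * ((i + 1) ^ 2 * (1 + δ) ^ (i + 1)))) := by
          refine ENNReal.tsum_le_tsum fun i => ?_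
          calc μ i * (1 + s) ^ i ≤ μ i * (1 + s * i + s ^ 2 * (i ^ 2 * (1 + s) ^ i)) := by
                gcongr; exact one_add_pow_le_sq s i
            _ = μ i + s * (μ i * i) + s ^ 2 * (μ i * (i ^ 2 * (1 + s) ^ i)) := by ring
            _ ≤ _ := by
              gcongr
              · exact le_self_add
              · exact le_self_add
              · exact i.le_succ
      _ = _ := by
          rw [ENNReal.tsum_add, ENNReal.tsum_add, ENNReal.tsum_mul_left, ENNReal.tsum_mul_left,
            hμ1, hmean, mul_one, mul_comm A]
  · have key : ∀ (π : PMF (ℕ × ℕ)),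
        ∑' c, π c * ((c.1 : ℝ≥0∞) * (1 + s) ^ c.1) ≤ A →
        ∑' c, π c * (1 + s) ^ c.1 ≤ 1 + A * s := by
      intro π hπ
      calc ∑' c, π c * (1 + s) ^ c.1
          ≤ ∑' c, (π c + s * (π c * ((c.1 : ℝ≥0∞) * (1 + s) ^ c.1))) := by
            refine ENNReal.tsum_le_tsum fun c => ?_
            calc π c * (1 + s) ^ c.1 ≤ π c * (1 + s * (c.1 * (1 + s) ^ c.1)) := by
                  gcongr; exact one_add_pow_le s c.1
              _ = _ := by ring
        _ ≤ _ := by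
            rw [ENNReal.tsum_add, ENNReal.tsum_mul_left, π.tsum_coe, mul_comm A]
            gcongr
    intro n
    refine key _ ?_
    cases n with
    | zero =>
      rw [spineLaw, rootLaw, tsum_map_mul _ _ fun c : ℕ × ℕ => (c.1 : ℝ≥0∞) * (1 + s) ^ c.1]
      refine ENNReal.tsum_le_tsum fun i => ?_
      gcongr
      · push_cast
        rw [sq]
        exact le_mul_of_one_le_left zero_le (hone i)
    | succ n =>
      rw [spineLaw, tsum_specialLaw_mul μ hμ fun i => (i : ℝ≥0∞) * (1 + s) ^ i]
      refine ENNReal.tsum_le_tsum fun i => ?_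
      calc (i : ℝ≥0∞) * (μ i * (i * (1 + s) ^ i)) = μ i * (i ^ 2 * (1 + s) ^ i) := by ring
        _ ≤ _ := by
              gcongr
              · exact le_self_add
              · exact le_self_add
              · exact i.le_succ

/-- A critical law with positive variance charges some `i ≥ 2`, hence a special vertex has with
positive probability a child that comes before its special child. -/
theorem tsum_specialLaw_index_ne_zero {μ : PMF ℕ} (hμ : IsCriticalOffspring μ) :
    ∑' c, specialLaw μ hμ c * c.2 ≠ 0 := by
  intro h0
  rw [ENNReal.tsum_eq_zero] at h0
  have h2 : ∀ i, 2 ≤ i → μ i = 0 := fun i hi => by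
    have := h0 (i, 1)
    rw [specialLaw_apply, if_pos (by omega)] at this
    simpa using this
  have h1 : μ 1 = 1 := by
    have := hμ.mean_eq_one
    rw [tsum_eq_single 1] at this
    · simpa using this
    · intro i hi
      rcases Nat.lt_or_ge i 2 with h | h
      · have : i = 0 := by omega
        subst this; simp
      · rw [h2 i h, mul_zero]
  have hμ0 : μ 0 = 0 := by
    have hsup : μ.support = {1} := (PMF.apply_eq_one_iff μ 1).1 h1
    rw [PMF.apply_eq_zero_iff, hsup]
    simp
  have := hμ.variance_pos
  rw [ENNReal.tsum_eq_zero.2] at this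
  · exact lt_irrefl _ this
  · intro i
    rcases Nat.lt_or_ge i 2 with h | h
    · interval_cases i
      · simp [hμ0]
      · simp
    · rw [h2 i h, mul_zero]

theorem index_lt_of_spineLaw_ne_zero {μ : PMF ℕ} (hμ : IsCriticalOffspring μ) (n : ℕ) {c : ℕ × ℕ}
    (hc : spineLaw μ hμ n c ≠ 0) : c.2 < c.1 := by
  cases n with
  | zero =>
    have hc' : c ∈ (rootLaw μ).support := hc
    rw [rootLaw, PMF.mem_support_map_iff] at hc'
    obtain ⟨i, -, rfl⟩ := hc'
    simp
  | succ n =>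
    by_contra hlt
    exact hc ((specialLaw_apply μ hμ c.1 c.2).trans (if_neg hlt))

/-! ### Independence of the coordinates of the sample -/

section IndependentCoordinates

/-- Two independent families, lifted to the product space, form together an independent family. -/
theorem iIndep_prod {Ω₁ Ω₂ ι κ : Type*} {mΩ₁ : MeasurableSpace Ω₁} {mΩ₂ : MeasurableSpace Ω₂}
    {μ₁ : Measure Ω₁} {μ₂ : Measure Ω₂} [IsProbabilityMeasure μ₁] [IsProbabilityMeasure μ₂]
    {m₁ : ι → MeasurableSpace Ω₁} {m₂ : κ → MeasurableSpace Ω₂}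
    (h₁ : ProbabilityTheory.iIndep m₁ μ₁) (h₂ : ProbabilityTheory.iIndep m₂ μ₂) :
    ProbabilityTheory.iIndep (Sum.elim (fun i => (m₁ i).comap Prod.fst)
      (fun j => (m₂ j).comap Prod.snd)) (μ₁.prod μ₂) := by
  classical
  rw [ProbabilityTheory.iIndep_iff] at h₁ h₂ ⊢
  intro s f hf
  have hA : ∀ i, ∃ A : Set Ω₁, Sum.inl i ∈ s →
      MeasurableSet[m₁ i] A ∧ Prod.fst ⁻¹' A = f (.inl i) := by
    intro i
    by_cases hi : Sum.inl i ∈ s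
    · obtain ⟨A, hA, hA'⟩ := hf _ hi
      exact ⟨A, fun _ => ⟨hA, hA'⟩⟩
    · exact ⟨∅, fun h => absurd h hi⟩
  have hB : ∀ j, ∃ B : Set Ω₂, Sum.inr j ∈ s →
      MeasurableSet[m₂ j] B ∧ Prod.snd ⁻¹' B = f (.inr j) := by
    intro j
    by_cases hj : Sum.inr j ∈ s
    · obtain ⟨B, hB, hB'⟩ := hf _ hj
      exact ⟨B, fun _ => ⟨hB, hB'⟩⟩
    · exact ⟨∅, fun h => absurd h hj⟩
  choose A hA using hA
  choose B hB using hB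
  have e : (⋂ i ∈ s, f i) = (⋂ i ∈ s.toLeft, A i) ×ˢ (⋂ j ∈ s.toRight, B j) := by
    ext ⟨x, y⟩
    simp only [Set.mem_iInter, Set.mem_prod, Finset.mem_toLeft, Finset.mem_toRight]
    constructor
    · intro h
      refine ⟨fun i hi => ?_, fun j hj => ?_⟩
      · have := h _ hi; rw [← (hA i hi).2] at this; exact this
      · have := h _ hj; rw [← (hB j hj).2] at this; exact this
    · rintro ⟨h, h'⟩ (i | j) hi
      · rw [← (hA i hi).2]; exact h i hi
      · rw [← (hB j hi).2]; exact h' j hi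
  rw [e, Measure.prod_prod, h₁ s.toLeft fun i hi => (hA i (Finset.mem_toLeft.1 hi)).1,
    h₂ s.toRight fun j hj => (hB j (Finset.mem_toRight.1 hj)).1,
    ← Finset.toLeft_disjSum_toRight (u := s), Finset.prod_disjSum, Finset.toLeft_disjSum,
    Finset.toRight_disjSum]
  congr 1
  · refine Finset.prod_congr rfl fun i hi => ?_
    rw [← (hA i (Finset.mem_toLeft.1 hi)).2, ← Set.prod_univ, Measure.prod_prod, measure_univ,
      mul_one]
  · refine Finset.prod_congr rfl fun j hj => ?_
    rw [← (hB j (Finset.mem_toRight.1 hj)).2, ← Set.univ_prod, Measure.prod_prod, measure_univ,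
      one_mul]

/-- The indices of the independent coordinates of a sample: offspring numbers of normal vertices,
offspring numbers and special indices on the spine, and increments. -/
abbrev Coord : Type := List ℕ ⊕ ℕ ⊕ List ℕ

/-- The σ-algebra generated by one coordinate of the sample. -/
@[reducible]
def coordSigma (d : ℕ) : Coord → MeasurableSpace (Sample d)
  | .inl u => MeasurableSpace.comap (fun ω => ω.1 u) inferInstance
  | .inr (.inl n) => MeasurableSpace.comap (fun ω => ω.2.1 n) inferInstance
  | .inr (.inr u) => MeasurableSpace.comap (fun ω => ω.2.2 u) inferInstance

/-- The σ-algebra generated by a set of coordinates of the sample. -/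
@[reducible]
def sigmaOf (d : ℕ) (S : Set Coord) : MeasurableSpace (Sample d) := ⨆ i ∈ S, coordSigma d i

theorem coordSigma_le (i : Coord) :
    coordSigma d i ≤ (inferInstance : MeasurableSpace (Sample d)) := by
  rcases i with u | n | u
  · exact ((measurable_pi_apply u).comp measurable_fst).comap_le
  · exact ((measurable_pi_apply n).comp (measurable_fst.comp measurable_snd)).comap_le
  · exact ((measurable_pi_apply u).comp (measurable_snd.comp measurable_snd)).comap_le

theorem sigmaOf_le (S : Set Coord) : sigmaOf d S ≤ (inferInstance : MeasurableSpace (Sample d)) :=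
  iSup₂_le fun i _ => coordSigma_le i

theorem sigmaOf_mono {S T : Set Coord} (h : S ⊆ T) : sigmaOf d S ≤ sigmaOf d T :=
  biSup_mono fun _ hi => h hi

theorem measurable_offspring {S : Set Coord} {u : List ℕ} (h : Sum.inl u ∈ S) :
    Measurable[sigmaOf d S] fun ω : Sample d => ω.1 u :=
  (comap_measurable _).mono (le_biSup (coordSigma d) h) le_rfl

theorem measurable_spine {S : Set Coord} {n : ℕ} (h : Sum.inr (Sum.inl n) ∈ S) :
    Measurable[sigmaOf d S] fun ω : Sample d => ω.2.1 n :=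
  (comap_measurable _).mono (le_biSup (coordSigma d) h) le_rfl

theorem measurable_increment {S : Set Coord} {u : List ℕ} (h : Sum.inr (Sum.inr u) ∈ S) :
    Measurable[sigmaOf d S] fun ω : Sample d => ω.2.2 u :=
  (comap_measurable _).mono (le_biSup (coordSigma d) h) le_rfl

variable [NeZero d] (μ : PMF ℕ) (hμ : IsCriticalOffspring μ)

instance : IsProbabilityMeasure (law d μ hμ) := by
  unfold law; infer_instance

/-- The coordinates of the sample are independent. -/
theorem iIndep_coordSigma : ProbabilityTheory.iIndep (coordSigma d) (law d μ hμ) := by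
  have h1 := ProbabilityTheory.iIndepFun_infinitePi (P := fun _ : List ℕ => μ.toMeasure)
    (X := fun _ x => x) (fun _ => measurable_id)
  have h2 := ProbabilityTheory.iIndepFun_infinitePi (P := fun n : ℕ => (spineLaw μ hμ n).toMeasure)
    (X := fun _ x => x) (fun _ => measurable_id)
  have h3 := ProbabilityTheory.iIndepFun_infinitePi (P := fun _ : List ℕ => (stepLaw d).toMeasure)
    (X := fun _ x => x) (fun _ => measurable_id)
  rw [ProbabilityTheory.iIndepFun_iff_iIndep] at h1 h2 h3
  have h := iIndep_prod h1 (iIndep_prod h2 h3)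
  convert! h using 1
  funext i
  rcases i with u | n | u <;> simp [coordSigma, MeasurableSpace.comap_comp, Function.comp_def]

variable {μ hμ}

/-- Functions of disjoint sets of coordinates are independent. -/
theorem lintegral_mul_of_disjoint {S T : Set Coord} (hST : Disjoint S T) {f g : Sample d → ℝ≥0∞}
    (hf : Measurable[sigmaOf d S] f) (hg : Measurable[sigmaOf d T] g) :
    ∫⁻ ω, f ω * g ω ∂law d μ hμ = (∫⁻ ω, f ω ∂law d μ hμ) * ∫⁻ ω, g ω ∂law d μ hμ :=
  ProbabilityTheory.lintegral_mul_eq_lintegral_mul_lintegral_of_independent_measurableSpace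
    (sigmaOf_le S) (sigmaOf_le T)
    (ProbabilityTheory.indep_iSup_of_disjoint coordSigma_le (iIndep_coordSigma μ hμ) hST) hf hg

theorem lintegral_prod_of_disjoint {S : ℕ → Set Coord} (hS : Pairwise (Function.onFun Disjoint S))
    {f : ℕ → Sample d → ℝ≥0∞} (hf : ∀ k, Measurable[sigmaOf d (S k)] (f k)) (t : Finset ℕ) :
    ∫⁻ ω, ∏ k ∈ t, f k ω ∂law d μ hμ = ∏ k ∈ t, ∫⁻ ω, f k ω ∂law d μ hμ := by
  classical
  induction t using Finset.induction_on with
  | empty => simp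
  | insert k t hk ih =>
    simp only [Finset.prod_insert hk]
    rw [lintegral_mul_of_disjoint (S := S k) (T := ⋃ j ∈ t, S j) ?_ (hf k) ?_, ih]
    · rw [Set.disjoint_iUnion₂_right]
      exact fun j hj => hS fun hkj => hk (hkj ▸ hj)
    · exact Finset.measurable_prod _ fun j hj => (hf j).mono
        (sigmaOf_mono (Set.subset_biUnion_of_mem (u := S) hj)) le_rfl

/-- Conditioning on the value of a discrete variable `N` that is independent of each `F c`. -/
theorem lintegral_select {β : Type*} [Countable β] {S T : Set Coord} (hST : Disjoint S T)
    {N : Sample d → β} (hN : ∀ c, MeasurableSet[sigmaOf d T] (N ⁻¹' {c}))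
    {F : β → Sample d → ℝ≥0∞} (hF : ∀ c, Measurable[sigmaOf d S] (F c)) :
    ∫⁻ ω, F (N ω) ω ∂law d μ hμ =
      ∑' c, law d μ hμ (N ⁻¹' {c}) * ∫⁻ ω, F c ω ∂law d μ hμ := by
  have h1 : ∀ ω, F (N ω) ω = ∑' c, (N ⁻¹' {c}).indicator 1 ω * F c ω := by
    intro ω
    rw [tsum_eq_single (N ω)]
    · simp
    · intro c hc
      simp [Set.indicator, hc.symm]
  have hind : ∀ c, Measurable[sigmaOf d T] ((N ⁻¹' {c}).indicator (1 : Sample d → ℝ≥0∞)) :=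
    fun c => Measurable.indicator (@measurable_const _ _ _ (sigmaOf d T) 1) (hN c)
  simp only [h1]
  have hF' : ∀ c, Measurable (F c) := fun c => (hF c).mono (sigmaOf_le S) le_rfl
  have hind' : ∀ c, Measurable ((N ⁻¹' {c}).indicator (1 : Sample d → ℝ≥0∞)) :=
    fun c => (hind c).mono (sigmaOf_le T) le_rfl
  rw [lintegral_tsum (f := fun c ω => (N ⁻¹' {c}).indicator 1 ω * F c ω)
    fun c => ((hind' c).mul (hF' c)).aemeasurable]
  refine tsum_congr fun c => ?_
  rw [lintegral_mul_of_disjoint hST.symm (hind c) (hF c), lintegral_indicator_one]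
  exact sigmaOf_le T _ (hN c)

theorem law_offspring (u : List ℕ) (i : ℕ) :
    law d μ hμ ((fun ω => ω.1 u) ⁻¹' {i}) = μ i := by
  have : ((fun ω : Sample d => ω.1 u) ⁻¹' {i}) =
      ((fun a : List ℕ → ℕ => a u) ⁻¹' {i}) ×ˢ Set.univ := by
    ext; simp
  rw [this, law, Measure.prod_prod, measure_univ, mul_one,
    ← Measure.map_apply (measurable_pi_apply u) (measurableSet_singleton i),
    Measure.infinitePi_map_eval, PMF.toMeasure_apply_singleton _ _ (measurableSet_singleton i)]

theorem law_spine (n : ℕ) (c : ℕ × ℕ) :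
    law d μ hμ ((fun ω => ω.2.1 n) ⁻¹' {c}) = spineLaw μ hμ n c := by
  have : ((fun ω : Sample d => ω.2.1 n) ⁻¹' {c}) =
      Set.univ ×ˢ (((fun a : ℕ → ℕ × ℕ => a n) ⁻¹' {c}) ×ˢ Set.univ) := by
    ext; simp
  rw [this, law, Measure.prod_prod, Measure.prod_prod, measure_univ, measure_univ, mul_one, one_mul,
    ← Measure.map_apply (measurable_pi_apply n) (measurableSet_singleton c),
    Measure.infinitePi_map_eval, PMF.toMeasure_apply_singleton _ _ (measurableSet_singleton c)]

theorem law_increment (u : List ℕ) (y : Fin d → ℤ) :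
    law d μ hμ ((fun ω => ω.2.2 u) ⁻¹' {y}) = stepLaw d y := by
  have : ((fun ω : Sample d => ω.2.2 u) ⁻¹' {y}) =
      Set.univ ×ˢ (Set.univ ×ˢ ((fun a : List ℕ → Fin d → ℤ => a u) ⁻¹' {y})) := by
    ext; simp
  rw [this, law, Measure.prod_prod, Measure.prod_prod, measure_univ, measure_univ, one_mul, one_mul,
    ← Measure.map_apply (measurable_pi_apply u) (measurableSet_singleton y),
    Measure.infinitePi_map_eval, PMF.toMeasure_apply_singleton _ _ (measurableSet_singleton y)]

theorem tsum_stepLaw_mul (g : (Fin d → ℤ) → ℝ≥0∞) (x : Fin d → ℤ) :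
    ∑' y, stepLaw d y * g (x + y) = avg g x := by
  rw [avg, tsum_eq_sum (s := nearestNeighbours d)]
  · refine Finset.sum_congr rfl fun e he => ?_
    rw [stepLaw, PMF.uniformOfFinset_apply_of_mem _ he]
  · intro e he
    rw [stepLaw, PMF.uniformOfFinset_apply_of_notMem _ he, zero_mul]

theorem measurable_select {Ω β γ : Type*} {m : MeasurableSpace Ω} [Countable β] [MeasurableSpace β]
    [MeasurableSingletonClass β] [MeasurableSpace γ] {N : Ω → β} (hN : Measurable N)
    {F : β → Ω → γ} (hF : ∀ c, Measurable (F c)) : Measurable fun ω => F (N ω) ω :=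
  (measurable_from_prod_countable_right (f := fun p : β × Ω => F p.1 p.2) hF).comp
    (hN.prodMk measurable_id)

end IndependentCoordinates

/-! ### Recursive counts of the vertices of a tree -/

section RecursiveCounts

/-- The offspring data of a vertex `v`. A type `none` stands for a normal vertex, and `some n` for
the spine vertex at height `n`. The second component is relevant for spine vertices only. -/
def offspringData (ω : Sample d) (τ : Option ℕ) (v : List ℕ) : ℕ × ℕ :=
  τ.elim (ω.1 v, 0) ω.2.1

/-- The type of the `k`-th child of a vertex of type `τ` whose special child has index `j`. -/
def childType (τ : Option ℕ) (j k : ℕ) : Option ℕ :=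
  τ.bind fun n => if k = j then some (n + 1) else none

/-- The number of children taken into account: all of them for a normal vertex, and as many as
prescribed by `tr` for a spine vertex. -/
def numKept (tr : ℕ × ℕ → ℕ) (τ : Option ℕ) (c : ℕ × ℕ) : ℕ :=
  τ.elim c.1 fun _ => tr c

/-- The sum, over the descendants up to generation `h` of a vertex `v` of type `τ`, of the value of
`f` at the type and the position of the descendant, the walk being at `x` at `v`. Spine vertices
keep the first `tr c` of their children, where `c` is their offspring data. -/
def count (tr : ℕ × ℕ → ℕ) (f : Option ℕ → (Fin d → ℤ) → ℕ) :
    ℕ → Option ℕ → List ℕ → (Fin d → ℤ) → Sample d → ℕ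
  | 0, τ, _, x, _ => f τ x
  | h + 1, τ, v, x, ω => f τ x + ∑ k ∈ Finset.range (numKept tr τ (offspringData ω τ v)),
      count tr f h (childType τ (offspringData ω τ v).2 k) (k :: v) (x + ω.2.2 (k :: v)) ω

/-- The coordinate that contains the offspring data of a vertex. -/
def dataCoord (τ : Option ℕ) (v : List ℕ) : Coord :=
  τ.elim (.inl v) fun n => .inr (.inl n)

/-- The coordinates on which the counts from `v` depend. -/
def depSet (τ : Option ℕ) (v : List ℕ) : Set Coord :=
  {i | i.elim (fun u => v <:+ u) fun j => j.elim (fun m => ∃ n ∈ τ, n ≤ m) fun u => v <:+ u ∧ u ≠ v}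

/-- The coordinates on which the contribution of the `k`-th child of `v` depends. -/
def childDepSet (τ : Option ℕ) (k : ℕ) (v : List ℕ) : Set Coord :=
  insert (.inr (.inr (k :: v))) (depSet τ (k :: v))

theorem dataCoord_mem (τ : Option ℕ) (v : List ℕ) : dataCoord τ v ∈ depSet τ v := by
  cases τ <;> simp [dataCoord, depSet]

theorem childDepSet_subset (τ : Option ℕ) (j k : ℕ) (v : List ℕ) :
    childDepSet (childType τ j k) k v ⊆ depSet τ v := by
  have hk : v <:+ k :: v := List.suffix_cons k v
  rintro i (rfl | hi)
  · simp [depSet]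
  · rcases i with u | m | u
    · exact hk.trans hi
    · obtain ⟨n, hn, hm⟩ := hi
      rcases τ with _ | n'
      · simp [childType] at hn
      · simp only [childType, Option.bind_some, Option.mem_def] at hn
        split_ifs at hn
        have : n' + 1 = n := by simpa using hn
        exact ⟨n', rfl, by omega⟩
    · refine ⟨hk.trans hi.1, ?_⟩
      rintro rfl
      have := hi.1.length_le
      simp at this

/-- The offspring data of `v` are independent of the subtrees of the children of `v`: spine data are
indexed by the height, which is larger for a special child. -/
theorem dataCoord_notMem (τ : Option ℕ) (j k : ℕ) (v : List ℕ) :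
    dataCoord τ v ∉ childDepSet (childType τ j k) k v := by
  have hk : ¬ k :: v <:+ v := fun h => by simpa using h.length_le
  rcases τ with _ | n
  · simpa [childDepSet, dataCoord, depSet] using hk
  · rintro (h | ⟨m, hm, hmn⟩)
    · simp [dataCoord] at h
    · simp only [childType, Option.bind_some, Option.mem_def] at hm
      split_ifs at hm
      have : n + 1 = m := by simpa using hm
      omega

theorem suffix_cons_unique {k k' : ℕ} {v u : List ℕ} (h : k :: v <:+ u) (h' : k' :: v <:+ u) :
    k = k' := by
  have := List.suffix_of_suffix_length_le h h' (by simp)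
  have := this.eq_of_length (by simp)
  simpa using this

/-- The subtrees of different children depend on disjoint sets of coordinates: the walk and the
normal offspring numbers are indexed by vertices, and only one child is special. -/
theorem childDepSet_disjoint (τ : Option ℕ) (j : ℕ) (v : List ℕ) :
    Pairwise (Function.onFun Disjoint fun k => childDepSet (childType τ j k) k v) := by
  intro k k' hkk'
  rw [Function.onFun, Set.disjoint_left]
  rintro (u | m | u) hi hi'
  · simp only [childDepSet, depSet, Set.mem_insert_iff, reduceCtorEq, Set.mem_ofPred_eq,
      Sum.elim_inl, false_or] at hi hi'
    exact hkk' (suffix_cons_unique hi hi')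
  · simp only [childDepSet, depSet, Set.mem_insert_iff, reduceCtorEq, Set.mem_ofPred_eq,
      Sum.elim_inl, Sum.elim_inr, Sum.inr.injEq, false_or] at hi hi'
    obtain ⟨n, hn, -⟩ := hi
    obtain ⟨n', hn', -⟩ := hi'
    rcases τ with _ | t
    · simp [childType] at hn
    · simp only [childType, Option.bind_some, Option.mem_def] at hn hn'
      split_ifs at hn hn'
      omega
  · have key : ∀ {τ k}, (Sum.inr (Sum.inr u) : Coord) ∈ childDepSet τ k v → k :: v <:+ u := by
      intro τ k h
      rcases h with h | h
      · simp at h; rw [h]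
      · exact h.1
    exact hkk' (suffix_cons_unique (key hi) (key hi'))

theorem measurable_offspringData {S : Set Coord} {τ : Option ℕ} {v : List ℕ}
    (h : dataCoord τ v ∈ S) : Measurable[sigmaOf d S] fun ω => offspringData ω τ v := by
  rcases τ with _ | n
  · exact (measurable_from_top (f := fun i : ℕ => (i, 0))).comp (measurable_offspring h)
  · exact measurable_spine h

theorem measurable_count (tr : ℕ × ℕ → ℕ) (f : Option ℕ → (Fin d → ℤ) → ℕ) (h : ℕ)
    (τ : Option ℕ) (v : List ℕ) (x : Fin d → ℤ) :
    Measurable[sigmaOf d (depSet τ v)] (count tr f h τ v x) := by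
  induction h generalizing τ v x with
  | zero => exact @measurable_const _ _ _ (sigmaOf d (depSet τ v)) _
  | succ h ih =>
    refine @measurable_select _ _ _ (sigmaOf d (depSet τ v)) _ _ _ _ _
      (measurable_offspringData (dataCoord_mem τ v)) (fun c ω => f τ x +
        ∑ k ∈ Finset.range (numKept tr τ c),
          count tr f h (childType τ c.2 k) (k :: v) (x + ω.2.2 (k :: v)) ω) fun c => ?_
    refine Measurable.const_add (Finset.measurable_sum _ fun k _ => ?_) _
    have hsub := childDepSet_subset τ c.2 k v
    refine @measurable_select _ _ _ (sigmaOf d (depSet τ v)) _ _ _ _ _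
      (measurable_increment (u := k :: v) (hsub (Set.mem_insert _ _)))
      (fun y ω => count tr f h (childType τ c.2 k) (k :: v) (x + y) ω) fun y => ?_
    exact (ih _ _ _).mono (sigmaOf_mono ((Set.subset_insert _ _).trans hsub)) le_rfl

theorem measurable_count_child (tr : ℕ × ℕ → ℕ) (f : Option ℕ → (Fin d → ℤ) → ℕ) (h : ℕ)
    (τ : Option ℕ) (k : ℕ) (v : List ℕ) (x : Fin d → ℤ) :
    Measurable[sigmaOf d (childDepSet τ k v)]
      fun ω => count tr f h τ (k :: v) (x + ω.2.2 (k :: v)) ω := by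
  refine @measurable_select _ _ _ (sigmaOf d (childDepSet τ k v)) _ _ _ _ _
    (measurable_increment (u := k :: v) (Set.mem_insert _ _))
    (fun y ω => count tr f h τ (k :: v) (x + y) ω) fun y => ?_
  exact (measurable_count tr f h τ (k :: v) _).mono (sigmaOf_mono (Set.subset_insert _ _)) le_rfl

theorem measurableSet_offspringData (τ : Option ℕ) (v : List ℕ) (c : ℕ × ℕ) :
    MeasurableSet[sigmaOf d {dataCoord τ v}] ((fun ω => offspringData ω τ v) ⁻¹' {c}) :=
  measurable_offspringData (Set.mem_singleton _) (measurableSet_singleton c)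

variable [NeZero d] {μ : PMF ℕ} {hμ : IsCriticalOffspring μ}

/-- The law of the offspring data. -/
def dataLaw (μ : PMF ℕ) (hμ : IsCriticalOffspring μ) (τ : Option ℕ) : PMF (ℕ × ℕ) :=
  τ.elim (μ.map fun i => (i, 0)) (spineLaw μ hμ)

theorem law_offspringData (τ : Option ℕ) (v : List ℕ) (c : ℕ × ℕ) :
    law d μ hμ ((fun ω => offspringData ω τ v) ⁻¹' {c}) = dataLaw μ hμ τ c := by
  classical
  rcases τ with _ | n
  · rw [dataLaw, Option.elim_none, PMF.map_apply, tsum_eq_single c.1]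
    · by_cases hc : c.2 = 0
      · have : ((fun ω : Sample d => offspringData ω none v) ⁻¹' {c}) =
            (fun ω => ω.1 v) ⁻¹' {c.1} := by
          ext ω; simp [offspringData, Prod.ext_iff, hc]
        rw [this, law_offspring, if_pos (show c = (c.1, 0) from Prod.ext rfl hc)]
      · have : ((fun ω : Sample d => offspringData ω none v) ⁻¹' {c}) = ∅ := by
          ext ω; simp [offspringData, Prod.ext_iff, Ne.symm hc]
        rw [this, measure_empty, if_neg fun h : c = (c.1, 0) => hc (congrArg Prod.snd h)]
    · intro i hi
      rw [if_neg fun h => hi (congrArg Prod.fst h).symm]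
  · exact law_spine n c

theorem lintegral_child (tr : ℕ × ℕ → ℕ) (f : Option ℕ → (Fin d → ℤ) → ℕ) (h : ℕ)
    (τ : Option ℕ) (k : ℕ) (v : List ℕ) (x : Fin d → ℤ) (g : ℕ → ℝ≥0∞) :
    ∫⁻ ω, g (count tr f h τ (k :: v) (x + ω.2.2 (k :: v)) ω) ∂law d μ hμ =
      avg (fun y => ∫⁻ ω, g (count tr f h τ (k :: v) y ω) ∂law d μ hμ) x := by
  have hST : Disjoint (depSet τ (k :: v)) {Sum.inr (Sum.inr (k :: v))} := by
    rw [Set.disjoint_singleton_right]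
    simp [depSet]
  rw [lintegral_select hST (N := fun ω => ω.2.2 (k :: v))
    (F := fun y ω => g (count tr f h τ (k :: v) (x + y) ω))
    (fun y => measurable_increment (Set.mem_singleton _) (measurableSet_singleton y))
    fun y => (measurable_from_top (f := g)).comp (measurable_count tr f h τ (k :: v) _)]
  simp only [law_increment]
  exact tsum_stepLaw_mul (fun y => ∫⁻ ω, g (count tr f h τ (k :: v) y ω) ∂law d μ hμ) x

/-- The recursion for exponential moments: subtrees of different children are independent. -/
theorem lintegral_pow_count_succ (tr : ℕ × ℕ → ℕ) (f : Option ℕ → (Fin d → ℤ) → ℕ) (q : ℝ≥0∞)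
    (h : ℕ) (τ : Option ℕ) (v : List ℕ) (x : Fin d → ℤ) :
    ∫⁻ ω, q ^ count tr f (h + 1) τ v x ω ∂law d μ hμ =
      q ^ f τ x * ∑' c, dataLaw μ hμ τ c * ∏ k ∈ Finset.range (numKept tr τ c),
        avg (fun y => ∫⁻ ω, q ^ count tr f h (childType τ c.2 k) (k :: v) y ω ∂law d μ hμ) x := by
  have hmeas : ∀ (c : ℕ × ℕ) k, Measurable[sigmaOf d (childDepSet (childType τ c.2 k) k v)]
      fun ω => q ^ count tr f h (childType τ c.2 k) (k :: v) (x + ω.2.2 (k :: v)) ω := fun c k =>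
    (measurable_from_top (f := fun n : ℕ => q ^ n)).comp (measurable_count_child ..)
  have hST : Disjoint ({dataCoord τ v}ᶜ : Set Coord) {dataCoord τ v} := disjoint_compl_left
  have hF : ∀ c : ℕ × ℕ, Measurable[sigmaOf d ({dataCoord τ v}ᶜ : Set Coord)] fun ω =>
      q ^ f τ x * ∏ k ∈ Finset.range (numKept tr τ c),
        q ^ count tr f h (childType τ c.2 k) (k :: v) (x + ω.2.2 (k :: v)) ω := by
    intro c
    refine Measurable.const_mul (Finset.measurable_prod _ fun k _ => ?_) _
    refine (hmeas c k).mono (sigmaOf_mono ?_) le_rfl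
    rw [Set.subset_compl_singleton_iff]
    exact dataCoord_notMem τ c.2 k v
  have := lintegral_select (μ := μ) (hμ := hμ) hST
    (measurableSet_offspringData τ v) hF
  simp only [count, pow_add, ← Finset.prod_pow_eq_pow_sum]
  rw [this, ← ENNReal.tsum_mul_left]
  refine tsum_congr fun c => ?_
  rw [law_offspringData, lintegral_const_mul, lintegral_prod_of_disjoint
    (childDepSet_disjoint τ c.2 v) (hmeas c)]
  · simp only [lintegral_child tr f h _ _ v x fun n => q ^ n]
    ring
  · exact Finset.measurable_prod _ fun k _ => (hmeas c k).mono (sigmaOf_le _) le_rfl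

/-- The recursion for first moments. -/
theorem lintegral_count_succ (tr : ℕ × ℕ → ℕ) (f : Option ℕ → (Fin d → ℤ) → ℕ)
    (h : ℕ) (τ : Option ℕ) (v : List ℕ) (x : Fin d → ℤ) :
    ∫⁻ ω, (count tr f (h + 1) τ v x ω : ℝ≥0∞) ∂law d μ hμ =
      f τ x + ∑' c, dataLaw μ hμ τ c * ∑ k ∈ Finset.range (numKept tr τ c),
        avg (fun y => ∫⁻ ω, (count tr f h (childType τ c.2 k) (k :: v) y ω : ℝ≥0∞) ∂law d μ hμ)
          x := by
  have hmeas : ∀ (c : ℕ × ℕ) k, Measurable[sigmaOf d (childDepSet (childType τ c.2 k) k v)]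
      fun ω => (count tr f h (childType τ c.2 k) (k :: v) (x + ω.2.2 (k :: v)) ω : ℝ≥0∞) :=
    fun c k => (measurable_from_top (f := fun n : ℕ => (n : ℝ≥0∞))).comp
      (measurable_count_child ..)
  have hST : Disjoint ({dataCoord τ v}ᶜ : Set Coord) {dataCoord τ v} := disjoint_compl_left
  have hF : ∀ c : ℕ × ℕ, Measurable[sigmaOf d ({dataCoord τ v}ᶜ : Set Coord)] fun ω =>
      ∑ k ∈ Finset.range (numKept tr τ c),
        (count tr f h (childType τ c.2 k) (k :: v) (x + ω.2.2 (k :: v)) ω : ℝ≥0∞) := by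
    intro c
    refine Finset.measurable_sum _ fun k _ => ?_
    refine (hmeas c k).mono (sigmaOf_mono ?_) le_rfl
    rw [Set.subset_compl_singleton_iff]
    exact dataCoord_notMem τ c.2 k v
  have := lintegral_select (μ := μ) (hμ := hμ) hST
    (measurableSet_offspringData τ v) hF
  simp only [count, Nat.cast_add, Nat.cast_sum]
  rw [lintegral_add_left measurable_const, lintegral_const, measure_univ, mul_one, this]
  congr 1
  refine tsum_congr fun c => ?_
  rw [law_offspringData, lintegral_finsetSum _ fun k _ => (hmeas c k).mono (sigmaOf_le _) le_rfl]
  simp only [lintegral_child tr f h _ _ v x fun n => (n : ℝ≥0∞)]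

end RecursiveCounts

/-! ### Moments of the counts -/

section Moments

/-- The children of a spine vertex that belong to the past, together with the special child. -/
def pastKept (c : ℕ × ℕ) : ℕ := if c.2 < c.1 then c.2 + 1 else 0

/-- The weight that counts the visits of normal vertices to `y`. -/
def pastWeight (y : Fin d → ℤ) (τ : Option ℕ) (x : Fin d → ℤ) : ℕ :=
  τ.elim (({y} : Set (Fin d → ℤ)).indicator 1 x) fun _ => 0

/-- The expected number of visits up to generation `h` of the walk indexed by a critical tree, where
`f` is the indicator function of the target. -/
def meanNormal (f : (Fin d → ℤ) → ℝ≥0∞) : ℕ → (Fin d → ℤ) → ℝ≥0∞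
  | 0 => f
  | h + 1 => avg (meanNormal f h) + f

/-- A lower bound for the expected number of visits of the part of the past that lies above a spine
vertex other than the root. -/
def meanSpine (β : ℝ≥0∞) (f : (Fin d → ℤ) → ℝ≥0∞) : ℕ → (Fin d → ℤ) → ℝ≥0∞
  | 0 => 0
  | h + 1 => avg (meanSpine β f h) + β • avg (meanNormal f h)

theorem monotone_meanNormal (f : (Fin d → ℤ) → ℝ≥0∞) : Monotone (meanNormal f) := by
  refine monotone_nat_of_le_succ fun h => ?_
  induction h with
  | zero => exact le_add_self
  | succ h ih => exact add_le_add_left (avg_mono ih) _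

theorem monotone_meanSpine (β : ℝ≥0∞) (f : (Fin d → ℤ) → ℝ≥0∞) : Monotone (meanSpine β f) := by
  refine monotone_nat_of_le_succ fun h => ?_
  induction h with
  | zero => exact fun _ => zero_le
  | succ h ih =>
    exact add_le_add (avg_mono ih) fun x =>
      mul_le_mul_right (avg_mono (monotone_meanNormal f h.le_succ) x) β

theorem potential_le_iSup_meanNormal (f : (Fin d → ℤ) → ℝ≥0∞) :
    potential f ≤ fun x => ⨆ h, meanNormal f h x := by
  refine potential_le_of_superharmonic fun x => ?_
  rw [Pi.add_apply, avg_iSup_of_monotone (monotone_meanNormal f), ENNReal.iSup_add]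
  exact iSup_le fun h => le_iSup (fun h => meanNormal f h x) (h + 1)

theorem potential_le_iSup_meanSpine (β : ℝ≥0∞) (f : (Fin d → ℤ) → ℝ≥0∞) :
    β • avg (potential (potential f)) ≤ fun x => ⨆ h, meanSpine β f h x := by
  rw [avg_potential, ← potential_smul]
  refine (potential_mono fun x =>
    mul_le_mul_right (avg_mono (potential_le_iSup_meanNormal f) x) β).trans ?_
  refine potential_le_of_superharmonic fun x => ?_
  rw [Pi.add_apply, avg_iSup_of_monotone (monotone_meanSpine β f),
    avg_iSup_of_monotone (monotone_meanNormal f), ENNReal.mul_iSup,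
    ENNReal.iSup_add_iSup_of_monotone
      (fun m n hmn => avg_mono (monotone_meanSpine β f hmn) x)
      (fun m n hmn => mul_le_mul_right (avg_mono (monotone_meanNormal f hmn) x) β)]
  exact iSup_le fun h => le_iSup (fun h => meanSpine β f h x) (h + 1)

variable [NeZero d] {μ : PMF ℕ} {hμ : IsCriticalOffspring μ}

/-- The weight that counts the visits to `Λ`. -/
def visitWeight (Λ : Finset (Fin d → ℤ)) (_ : Option ℕ) (x : Fin d → ℤ) : ℕ :=
  (Λ : Set (Fin d → ℤ)).indicator 1 x

theorem avg_one_add (φ : (Fin d → ℤ) → ℝ≥0∞) (x : Fin d → ℤ) :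
    avg (fun y => 1 + φ y) x = 1 + avg φ x := by
  have h := avg_add (fun _ => 1) φ
  rw [avg_const] at h
  exact congrFun h x

/-- Supersolutions of the branching recursions bound the exponential moments of the time spent in
`Λ` up to any generation, by induction on the generation. -/
theorem lintegral_pow_count_le {Λ : Finset (Fin d → ℤ)} {A δ θ q : ℝ≥0∞}
    {φ ψ : (Fin d → ℤ) → ℝ≥0∞}
    (hgen : ∀ s ≤ δ, ∑' i, μ i * (1 + s) ^ i ≤ 1 + s + A * s ^ 2 ∧
      ∀ n, ∑' c, spineLaw μ hμ n c * (1 + s) ^ c.1 ≤ 1 + A * s)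
    (hq : q ≤ 1 + 2 * θ) (hφδ : ∀ x, avg φ x ≤ δ)
    (hφ : ∀ x, (1 + 2 * θ * Set.indicator Λ 1 x) * (1 + avg φ x + A * avg φ x ^ 2) ≤ 1 + φ x)
    (hψ : ∀ x, (1 + 2 * θ * Set.indicator Λ 1 x) * ((1 + A * avg φ x) * (1 + avg ψ x)) ≤ 1 + ψ x)
    (h : ℕ) (τ : Option ℕ) (v : List ℕ) (x : Fin d → ℤ) :
    ∫⁻ ω, q ^ count Prod.fst (visitWeight Λ) h τ v x ω ∂law d μ hμ ≤
      1 + τ.elim φ (fun _ => ψ) x := by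
  have hq1 : ∀ τ x, q ^ visitWeight Λ τ x ≤ 1 + 2 * θ * Set.indicator Λ 1 x := by
    intro τ x
    by_cases hx : x ∈ Λ
    · simpa [visitWeight, hx] using hq
    · simp [visitWeight, hx]
  induction h generalizing τ v x with
  | zero =>
    simp only [count, lintegral_const, measure_univ, mul_one]
    refine (hq1 τ x).trans ?_
    rcases τ with _ | n
    · refine le_trans (le_mul_of_one_le_right zero_le ?_) (hφ x)
      rw [add_assoc]; exact le_self_add
    · refine le_trans (le_mul_of_one_le_right zero_le ?_) (hψ x)
      exact one_le_mul le_self_add le_self_add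
  | succ h ih =>
    rw [lintegral_pow_count_succ]
    have hchild : ∀ (τ : Option ℕ) (j k : ℕ),
        avg (fun y => ∫⁻ ω, q ^ count Prod.fst (visitWeight Λ) h (childType τ j k) (k :: v) y ω
          ∂law d μ hμ) x ≤ 1 + avg ((childType τ j k).elim φ fun _ => ψ) x := by
      intro τ j k
      rw [← avg_one_add]
      exact avg_mono (fun y => ih _ _ y) x
    rcases τ with _ | n
    · refine le_trans ?_ (hφ x)
      refine mul_le_mul' (hq1 _ x) (le_trans ?_ (hgen _ (hφδ x)).1)
      rw [dataLaw, Option.elim_none, tsum_map_mul]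
      gcongr with i
      refine (Finset.prod_le_pow_card _ _ (1 + avg φ x) fun k _ => hchild none (i, 0).2 k).trans ?_
      simp [numKept]
    · refine le_trans ?_ (hψ x)
      refine mul_le_mul' (hq1 _ x) (le_trans ?_ (mul_le_mul_left ((hgen _ (hφδ x)).2 n) _))
      rw [← ENNReal.tsum_mul_right]
      refine ENNReal.tsum_le_tsum fun c => ?_
      rw [mul_assoc]
      refine mul_le_mul_right ?_ _
      calc _ ≤ ∏ k ∈ Finset.range c.1,
            ((1 + avg φ x) * if k = c.2 then 1 + avg ψ x else 1) := by
            refine Finset.prod_le_prod' fun k _ => (hchild (some n) c.2 k).trans ?_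
            by_cases hk : k = c.2
            · simp only [childType, hk, Option.bind_some, if_true, Option.elim_some]
              exact le_mul_of_one_le_left zero_le le_self_add
            · simp [childType, hk]
        _ ≤ _ := by
            rw [Finset.prod_mul_distrib, Finset.prod_const, Finset.card_range,
              Finset.prod_ite_eq']
            gcongr
            split_ifs
            · exact le_rfl
            · exact le_self_add

/-- Since the offspring law has mean `1`, the expected occupation of a normal subtree is that of one
simple random walk. -/
theorem meanNormal_le (y : Fin d → ℤ) (h : ℕ) (v : List ℕ) (x : Fin d → ℤ) :
    meanNormal (Set.indicator {y} 1) h x ≤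
      ∫⁻ ω, (count pastKept (pastWeight y) h none v x ω : ℝ≥0∞) ∂law d μ hμ := by
  have hw : ∀ x, (pastWeight y none x : ℝ≥0∞) = Set.indicator {y} 1 x := by
    intro x
    by_cases hx : x = y <;> simp [pastWeight, hx]
  induction h generalizing v x with
  | zero => simp [meanNormal, count, hw]
  | succ h ih =>
    rw [lintegral_count_succ, meanNormal, Pi.add_apply, hw, add_comm]
    gcongr
    rw [dataLaw, Option.elim_none, tsum_map_mul]
    calc avg (meanNormal (Set.indicator {y} 1) h) x
        = ∑' i : ℕ, μ i * (i * avg (meanNormal (Set.indicator {y} 1) h) x) := by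
          simp only [← mul_assoc]
          rw [ENNReal.tsum_mul_right]
          simp only [mul_comm (μ _)]
          rw [hμ.mean_eq_one, one_mul]
      _ ≤ _ := by
          gcongr with i
          calc _ = ∑ _k ∈ Finset.range i, avg (meanNormal (Set.indicator {y} 1) h) x := by simp
            _ ≤ _ := Finset.sum_le_sum fun k _ => avg_mono (fun z => ih (k :: v) z) x

/-- A spine vertex contributes its special child and, on average, `∑ c, spineLaw μ hμ n c * c.2`
normal children that come before it. -/
theorem tsum_spine_le (y : Fin d → ℤ) (h n : ℕ) (v : List ℕ) (x : Fin d → ℤ)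
    {g : (Fin d → ℤ) → ℝ≥0∞}
    (hg : ∀ v x, g x ≤ ∫⁻ ω, (count pastKept (pastWeight y) h (some (n + 1)) v x ω : ℝ≥0∞)
      ∂law d μ hμ) :
    avg g x + (∑' c, spineLaw μ hμ n c * c.2) * avg (meanNormal (Set.indicator {y} 1) h) x ≤
      ∫⁻ ω, (count pastKept (pastWeight y) (h + 1) (some n) v x ω : ℝ≥0∞) ∂law d μ hμ := by
  rw [lintegral_count_succ]
  refine le_trans ?_ le_add_self
  set z := avg (meanNormal (Set.indicator {y} 1) h) x
  calc avg g x + (∑' c, spineLaw μ hμ n c * c.2) * z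
      = ∑' c, spineLaw μ hμ n c * (c.2 * z + avg g x) := by
        simp only [mul_add, ← mul_assoc]
        rw [ENNReal.tsum_add, ENNReal.tsum_mul_right, ENNReal.tsum_mul_right, PMF.tsum_coe, one_mul,
          add_comm]
    _ ≤ _ := by
        refine ENNReal.tsum_le_tsum fun c => ?_
        by_cases hc : spineLaw μ hμ n c = 0
        · simp [hc]
        have hlt := index_lt_of_spineLaw_ne_zero hμ n hc
        rw [dataLaw, Option.elim_some]
        refine mul_le_mul_right ?_ _
        rw [numKept, Option.elim_some, pastKept, if_pos hlt, Finset.sum_range_succ]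
        refine add_le_add ?_ ?_
        · calc c.2 * z = ∑ _k ∈ Finset.range c.2, z := by simp
            _ ≤ _ := by
                refine Finset.sum_le_sum fun k hk => ?_
                have : childType (some n) c.2 k = none := by
                  simp [childType, (Finset.mem_range.1 hk).ne]
                rw [this]
                exact avg_mono (fun w => meanNormal_le y h _ w) x
        · have : childType (some n) c.2 c.2 = some (n + 1) := by simp [childType]
          rw [this]
          exact avg_mono (fun w => hg _ w) x

theorem meanSpine_le (y : Fin d → ℤ) (h n : ℕ) (v : List ℕ) (x : Fin d → ℤ) :
    meanSpine (∑' c, specialLaw μ hμ c * c.2) (Set.indicator {y} 1) h x ≤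
      ∫⁻ ω, (count pastKept (pastWeight y) h (some (n + 1)) v x ω : ℝ≥0∞) ∂law d μ hμ := by
  induction h generalizing n v x with
  | zero => simp [meanSpine]
  | succ h ih => exact tsum_spine_le y h (n + 1) v x fun v x => ih (n + 1) v x

theorem avg_meanSpine_le (y : Fin d → ℤ) (h : ℕ) (x : Fin d → ℤ) :
    avg (meanSpine (∑' c, specialLaw μ hμ c * c.2) (Set.indicator {y} 1) h) x ≤
      ∫⁻ ω, (count pastKept (pastWeight y) (h + 1) (some 0) [] x ω : ℝ≥0∞) ∂law d μ hμ :=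
  le_self_add.trans (tsum_spine_le y h 0 [] x fun v x => meanSpine_le y h 0 v x)

end Moments

/-! ### Comparison of the tree with the recursive counts -/

theorem tsum_list_eq (G : List ℕ → ℝ≥0∞) :
    ∑' w, G w = G [] + ∑' k, ∑' w, G (w ++ [k]) := by
  let e : Unit ⊕ ℕ × List ℕ ≃ List ℕ :=
    { toFun := Sum.elim (fun _ => []) fun p => p.1 :: p.2
      invFun := fun w => match w with
        | [] => .inl ()
        | k :: w => .inr (k, w)
      left_inv := fun o => by rcases o with _ | ⟨k, w⟩ <;> rfl
      right_inv := fun w => by cases w <;> rfl }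
  have hrev : Function.Involutive (List.reverse : List ℕ → List ℕ) := List.reverse_reverse
  have h1 : ∀ H : List ℕ → ℝ≥0∞, ∑' w : List ℕ, H w.reverse = ∑' w, H w := fun H =>
    hrev.toPerm.tsum_eq H
  rw [← h1 G, ← e.tsum_eq, ENNReal.summable.tsum_sum ENNReal.summable, tsum_fintype,
    ENNReal.tsum_prod']
  refine congrArg₂ _ (by simp [e]) (tsum_congr fun k => ?_)
  rw [← h1 fun w => G (w ++ [k])]
  exact tsum_congr fun w => by simp [e]

theorem tsum_append_eq (g : List ℕ → ℝ≥0∞) (v : List ℕ) :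
    ∑' w, g (w ++ v) = g v + ∑' k, ∑' w, g (w ++ k :: v) := by
  rw [tsum_list_eq fun w => g (w ++ v)]
  simp

theorem tsum_append_truncate_succ (g : List ℕ → ℝ≥0∞) (h : ℕ) (v : List ℕ) :
    ∑' w : List ℕ, (if w.length ≤ h + 1 then g (w ++ v) else 0) =
      g v + ∑' k, ∑' w : List ℕ, if w.length ≤ h then g (w ++ k :: v) else 0 := by
  rw [tsum_list_eq]
  simp

theorem tsum_append_truncate_zero (g : List ℕ → ℝ≥0∞) (v : List ℕ) :
    ∑' w : List ℕ, (if w.length ≤ 0 then g (w ++ v) else 0) = g v := by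
  rw [tsum_list_eq]
  simp

/-- The vertex `v` has type `τ`. -/
def HasType (ω : Sample d) (τ : Option ℕ) (v : List ℕ) : Prop :=
  τ.elim (v ≠ spine ω v.length) fun n => v = spine ω n

theorem length_spine (ω : Sample d) (n : ℕ) : (spine ω n).length = n := by
  induction n with
  | zero => rfl
  | succ n ih => simp [spine, ih]

theorem HasType.numChildren_eq {ω : Sample d} {τ : Option ℕ} {v : List ℕ} (h : HasType ω τ v) :
    numChildren ω v = (offspringData ω τ v).1 := by
  rcases τ with _ | n
  · exact if_neg h
  · have h' : v = spine ω n := h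
    subst h'
    rw [numChildren, length_spine, if_pos rfl]
    rfl

theorem HasType.child {ω : Sample d} {τ : Option ℕ} {v : List ℕ} (h : HasType ω τ v) (k : ℕ) :
    HasType ω (childType τ (offspringData ω τ v).2 k) (k :: v) := by
  rcases τ with _ | n
  · intro h'
    exact h (List.cons.inj h').2
  · have h' : v = spine ω n := h
    subst h'
    by_cases hk : k = (ω.2.1 n).2
    · have : childType (some n) (offspringData ω (some n) (spine ω n)).2 k = some (n + 1) := by
        simp [childType, offspringData, hk]
      rw [this, hk]
      rfl
    · have : childType (some n) (offspringData ω (some n) (spine ω n)).2 k = none := by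
        simp [childType, offspringData, hk]
      rw [this]
      intro h'
      rw [List.length_cons, length_spine] at h'
      exact hk (List.cons.inj h').1

theorem mem_tree_of_append {ω : Sample d} {w u : List ℕ} (h : w ++ u ∈ tree ω) : u ∈ tree ω := by
  induction w with
  | nil => exact h
  | cons k w ih => exact ih h.1

/-- The vertices of the tree in the first `h` generations above `v` are among those enumerated by
`count`. -/
theorem tsum_truncate_le_count (ω : Sample d) (x : Fin d → ℤ) (Λ : Finset (Fin d → ℤ)) (h : ℕ)
    {τ : Option ℕ} {v : List ℕ} (hv : HasType ω τ v) :
    ∑' w : List ℕ, (if w.length ≤ h then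
      {u | u ∈ tree ω ∧ walk ω x u ∈ Λ}.indicator 1 (w ++ v) else 0) ≤
      (count Prod.fst (visitWeight Λ) h τ v (walk ω x v) ω : ℝ≥0∞) := by
  classical
  set g : List ℕ → ℝ≥0∞ := {u | u ∈ tree ω ∧ walk ω x u ∈ Λ}.indicator 1 with hg
  have hgv : ∀ τ v, g v ≤ (visitWeight Λ τ (walk ω x v) : ℝ≥0∞) := by
    intro τ v
    by_cases hw : walk ω x v ∈ Λ
    · simp only [visitWeight, hg]
      rw [Set.indicator_of_mem (Finset.mem_coe.2 hw)]
      exact (Set.indicator_le_self _ _ _).trans (by simp)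
    · simp [hg, hw]
  induction h generalizing τ v with
  | zero =>
    rw [tsum_append_truncate_zero]
    exact hgv τ v
  | succ h ih =>
    rw [tsum_append_truncate_succ, count, Nat.cast_add, Nat.cast_sum]
    refine add_le_add (hgv τ v) ?_
    have hkept : numKept Prod.fst τ (offspringData ω τ v) = numChildren ω v := by
      rw [hv.numChildren_eq]
      cases τ <;> rfl
    rw [hkept, tsum_eq_sum (s := Finset.range (numChildren ω v))]
    · exact Finset.sum_le_sum fun k _ => ih (hv.child k)
    · intro k hk
      refine ENNReal.tsum_eq_zero.2 fun w => ?_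
      have : w ++ k :: v ∉ tree ω := fun hmem =>
        hk (Finset.mem_range.2 (mem_tree_of_append (w := w) hmem).2)
      simp [hg, this]

theorem localTime_eq_tsum (ω : Sample d) (x : Fin d → ℤ) (Λ : Finset (Fin d → ℤ)) :
    localTime ω x Λ = ∑' u : List ℕ, {u | u ∈ tree ω ∧ walk ω x u ∈ Λ}.indicator 1 u := by
  classical
  simp only [localTime, visits]
  rw [← Summable.tsum_finsetSum fun _ _ => ENNReal.summable]
  refine tsum_congr fun u => ?_
  by_cases hu : u ∈ tree ω
  · by_cases hw : walk ω x u ∈ Λ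
    · rw [Finset.sum_eq_single (walk ω x u)]
      · simp [hu, hw]
      · intro y _ hy
        simp [hy.symm]
      · exact fun h => absurd hw h
    · rw [Finset.sum_eq_zero]
      · simp [hw]
      · intro y hy
        have : walk ω x u ≠ y := fun h => hw (h ▸ hy)
        simp [this]
  · simp [hu]

/-- The time spent in `Λ` by the walk indexed by the first `h` generations of the tree. -/
def truncatedTime (ω : Sample d) (x : Fin d → ℤ) (Λ : Finset (Fin d → ℤ)) (h : ℕ) : ℝ≥0∞ :=
  ∑' u : List ℕ, if u.length ≤ h then {u | u ∈ tree ω ∧ walk ω x u ∈ Λ}.indicator 1 u else 0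

theorem truncatedTime_le_count (ω : Sample d) (x : Fin d → ℤ) (Λ : Finset (Fin d → ℤ)) (h : ℕ) :
    truncatedTime ω x Λ h ≤ (count Prod.fst (visitWeight Λ) h (some 0) [] x ω : ℝ≥0∞) := by
  simpa [truncatedTime, walk] using
    tsum_truncate_le_count ω x Λ h (τ := some 0) (v := []) rfl

theorem monotone_truncatedTime (ω : Sample d) (x : Fin d → ℤ) (Λ : Finset (Fin d → ℤ)) :
    Monotone (truncatedTime ω x Λ) := by
  intro m n hmn
  refine ENNReal.tsum_le_tsum fun u => ?_
  split_ifs with h1 h2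
  · exact le_rfl
  · omega
  · exact zero_le
  · exact le_rfl

theorem localTime_eq_iSup (ω : Sample d) (x : Fin d → ℤ) (Λ : Finset (Fin d → ℤ)) :
    localTime ω x Λ = ⨆ h, truncatedTime ω x Λ h := by
  rw [localTime_eq_tsum]
  refine le_antisymm ?_ (iSup_le fun h => ENNReal.tsum_le_tsum fun u => ?_)
  · rw [ENNReal.tsum_eq_iSup_sum]
    refine iSup_le fun s => le_iSup_of_le (s.sup List.length) ?_
    refine le_trans (Finset.sum_le_sum fun u hu => ?_) (ENNReal.sum_le_tsum s)
    rw [if_pos (Finset.le_sup (f := List.length) hu)]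
  · split_ifs
    · exact le_rfl
    · exact zero_le

theorem lt_and_le_of_lt_pastKept {c : ℕ × ℕ} {k : ℕ} (h : k < pastKept c) :
    c.2 < c.1 ∧ k ≤ c.2 := by
  unfold pastKept at h
  split_ifs at h with h1
  · omega
  · omega

/-- The vertices enumerated by `count pastKept` are distinct vertices of the tree, and the normal
ones belong to the past. -/
theorem count_le_tsum_past (ω : Sample d) (x y : Fin d → ℤ) (h : ℕ) {τ : Option ℕ} {v : List ℕ}
    (hv : HasType ω τ v) (hmem : v ∈ tree ω)
    (hpast : τ = none → ∃ n, ∃ k < (ω.2.1 n).2, (k :: spine ω n) <:+ v) :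
    (count pastKept (pastWeight y) h τ v (walk ω x v) ω : ℝ≥0∞) ≤
      ∑' w : List ℕ, {u | u ∈ past ω ∧ walk ω x u = y}.indicator 1 (w ++ v) := by
  classical
  set g : List ℕ → ℝ≥0∞ := {u | u ∈ past ω ∧ walk ω x u = y}.indicator 1 with hg
  have hgv : ∀ τ v, v ∈ tree ω → (τ = none → ∃ n, ∃ k < (ω.2.1 n).2, (k :: spine ω n) <:+ v) →
      (pastWeight y τ (walk ω x v) : ℝ≥0∞) ≤ g v := by
    rintro (_ | n) v hmem hpast
    · have hp : v ∈ past ω := ⟨hmem, Or.inr (hpast rfl)⟩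
      by_cases hw : walk ω x v = y
      · simp [hg, hp, hw, pastWeight]
      · simp [hw, pastWeight]
    · simp [pastWeight]
  induction h generalizing τ v with
  | zero =>
    rw [tsum_append_eq]
    exact (hgv τ v hmem hpast).trans le_self_add
  | succ h ih =>
    rw [tsum_append_eq, count, Nat.cast_add, Nat.cast_sum]
    refine add_le_add (hgv τ v hmem hpast) (le_trans ?_ (ENNReal.sum_le_tsum
      (Finset.range (numKept pastKept τ (offspringData ω τ v)))))
    refine Finset.sum_le_sum fun k hk => ?_
    rw [Finset.mem_range] at hk
    have hchild : k :: v ∈ tree ω := by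
      refine ⟨hmem, ?_⟩
      rw [hv.numChildren_eq]
      rcases τ with _ | n
      · exact hk
      · have := lt_and_le_of_lt_pastKept hk
        omega
    have hpast' : childType τ (offspringData ω τ v).2 k = none →
        ∃ n, ∃ k' < (ω.2.1 n).2, (k' :: spine ω n) <:+ k :: v := by
      intro hnone
      rcases τ with _ | n
      · obtain ⟨n, k', hk', hsuf⟩ := hpast rfl
        exact ⟨n, k', hk', hsuf.trans (List.suffix_cons k v)⟩
      · have h' : v = spine ω n := hv
        subst h'
        refine ⟨n, k, ?_, List.suffix_rfl⟩
        have hne : k ≠ (ω.2.1 n).2 := by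
          rintro rfl
          simp [childType, offspringData] at hnone
        have : k ≤ (ω.2.1 n).2 := (lt_and_le_of_lt_pastKept hk).2
        omega
    exact ih (hv.child k) hchild hpast'

theorem count_le_visits_past (ω : Sample d) (x y : Fin d → ℤ) (h : ℕ) :
    (count pastKept (pastWeight y) h (some 0) [] x ω : ℝ≥0∞) ≤ visits ω (past ω) x y := by
  simpa [visits, walk] using
    count_le_tsum_past ω x y h (τ := some 0) (v := []) rfl trivial (by simp)

/-! ### Exponential moments and the lower bound for the Green's function -/

section ExponentialMoments

theorem measurable_pow_count (tr : ℕ × ℕ → ℕ) (f : Option ℕ → (Fin d → ℤ) → ℕ) (h : ℕ)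
    (τ : Option ℕ) (v : List ℕ) (x : Fin d → ℤ) (g : ℕ → ℝ≥0∞) :
    Measurable fun ω => g (count tr f h τ v x ω) :=
  (measurable_from_top (f := g)).comp ((measurable_count tr f h τ v x).mono (sigmaOf_le _) le_rfl)

theorem visits_past_le_localTime (ω : Sample d) (x y : Fin d → ℤ) :
    visits ω (past ω) x y ≤ localTime ω x {y} := by
  rw [localTime, Finset.sum_singleton]
  refine ENNReal.tsum_le_tsum fun u => Set.indicator_le_indicator_of_subset ?_ (fun _ => zero_le) u
  exact fun u hu => ⟨hu.1.1, hu.2⟩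

theorem exp_le_one_add_two_mul {θ : ℝ} (h0 : 0 ≤ θ) (h1 : θ ≤ 1) : Real.exp θ ≤ 1 + 2 * θ := by
  have := Real.abs_exp_sub_one_le (x := θ) (by rwa [abs_of_nonneg h0])
  rw [abs_of_nonneg h0] at this
  linarith [le_abs_self (Real.exp θ - 1)]

variable [NeZero d] {μ : PMF ℕ} {hμ : IsCriticalOffspring μ}

/-- For `θ` small compared with the inverse of the supremum of `a ⋆ a ⋆ 1_Λ`, the exponential moment
of order `θ` of the time spent in `Λ` is at most `2`, uniformly in the starting point. -/
theorem exists_exponential_moment {a b : (Fin d → ℤ) → ℝ≥0∞} {D : ℝ≥0∞} (hk : IsGreenKernel a b D)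
    (hexp : HasExponentialMoment μ) (hμ : IsCriticalOffspring μ) :
    ∃ ε : ℝ≥0∞, ε ≠ 0 ∧ ε ≠ ⊤ ∧ ∀ Λ : Finset (Fin d → ℤ), Λ.Nonempty → ∀ θ : ℝ, 0 < θ →
      ENNReal.ofReal θ * (⨆ x, conv a (conv a (Set.indicator Λ 1)) x) ≤ ε → ∀ h x,
      ∫⁻ ω, ENNReal.ofReal (Real.exp θ) ^ count Prod.fst (visitWeight Λ) h (some 0) [] x ω
        ∂law d μ hμ ≤ 2 := by
  obtain ⟨A, δ, hA, hδ, hgen⟩ := exists_generating_bounds hμ hexp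
  obtain ⟨ε, hε, hεt, hsol⟩ := exists_supersolution hk hA hδ
  refine ⟨ε, hε, hεt, fun Λ hΛ θ hθ hθε h x => ?_⟩
  obtain ⟨hθ1, φ, ψ, hφδ, hψ1, hφ, hψ⟩ := hsol Λ hΛ _ hθε
  have hθ1' : θ ≤ 1 := by simpa using hθ1
  have hq : ENNReal.ofReal (Real.exp θ) ≤ 1 + 2 * ENNReal.ofReal θ := by
    refine (ENNReal.ofReal_le_ofReal (exp_le_one_add_two_mul hθ.le hθ1')).trans (le_of_eq ?_)
    rw [ENNReal.ofReal_add zero_le_one (by positivity), ENNReal.ofReal_mul zero_le_two]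
    simp
  refine (lintegral_pow_count_le hgen hq hφδ hφ hψ h (some 0) [] x).trans ?_
  rw [Option.elim_some]
  calc 1 + ψ x ≤ 1 + 1 := by gcongr; exact hψ1 x
    _ = 2 := one_add_one_eq_two

/-- Markov's inequality for the exponential of the time spent in `Λ`. -/
theorem law_localTime_gt_le {Λ : Finset (Fin d → ℤ)} {θ : ℝ} (hθ : 0 < θ) (x : Fin d → ℤ)
    (hmom : ∀ h, ∫⁻ ω, ENNReal.ofReal (Real.exp θ) ^
      count Prod.fst (visitWeight Λ) h (some 0) [] x ω ∂law d μ hμ ≤ 2) {t : ℝ} (ht : 0 < t) :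
    law d μ hμ {ω | ENNReal.ofReal t < localTime ω x Λ} ≤
      ENNReal.ofReal (2 * Real.exp (-(θ * t))) := by
  have hset : {ω : Sample d | ENNReal.ofReal t < localTime ω x Λ} =
      ⋃ h, {ω | ENNReal.ofReal t < truncatedTime ω x Λ h} := by
    ext ω
    simp [localTime_eq_iSup, lt_iSup_iff]
  have hmono : Monotone fun h => {ω : Sample d | ENNReal.ofReal t < truncatedTime ω x Λ h} :=
    fun m n hmn ω hω => lt_of_lt_of_le hω (monotone_truncatedTime ω x Λ hmn)
  rw [hset, hmono.measure_iUnion]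
  refine iSup_le fun h => ?_
  set X := count Prod.fst (visitWeight Λ) h (some 0) [] x with hX
  have hsub : {ω : Sample d | ENNReal.ofReal t < truncatedTime ω x Λ h} ⊆
      {ω | ENNReal.ofReal (Real.exp (θ * t)) ≤ ENNReal.ofReal (Real.exp θ) ^ X ω} := by
    intro ω hω
    have h1 : ENNReal.ofReal t < (X ω : ℝ≥0∞) :=
      lt_of_lt_of_le hω (truncatedTime_le_count ω x Λ h)
    have h2 : t < X ω := by
      rwa [← ENNReal.ofReal_natCast, ENNReal.ofReal_lt_ofReal_iff_of_nonneg ht.le] at h1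
    rw [Set.mem_ofPred_eq, ← ENNReal.ofReal_pow (Real.exp_pos _).le, ← Real.exp_nat_mul]
    refine ENNReal.ofReal_le_ofReal (Real.exp_le_exp.2 ?_)
    nlinarith
  have hmarkov := (mul_meas_ge_le_lintegral (μ := law d μ hμ)
    (measurable_pow_count Prod.fst (visitWeight Λ) h (some 0) [] x
      fun n => ENNReal.ofReal (Real.exp θ) ^ n) (ENNReal.ofReal (Real.exp (θ * t)))).trans (hmom h)
  have hpos : ENNReal.ofReal (Real.exp (θ * t)) ≠ 0 := by
    simpa using Real.exp_pos _
  calc law d μ hμ {ω : Sample d | ENNReal.ofReal t < truncatedTime ω x Λ h}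
      ≤ law d μ hμ {ω | ENNReal.ofReal (Real.exp (θ * t)) ≤ ENNReal.ofReal (Real.exp θ) ^ X ω} :=
        measure_mono hsub
    _ ≤ 2 / ENNReal.ofReal (Real.exp (θ * t)) := by
        rw [ENNReal.le_div_iff_mul_le (Or.inl hpos) (Or.inl ENNReal.ofReal_ne_top), mul_comm]
        exact hmarkov
    _ = ENNReal.ofReal (2 * Real.exp (-(θ * t))) := by
        rw [Real.exp_neg, ← div_eq_mul_inv, ENNReal.ofReal_div_of_pos (Real.exp_pos _)]
        simp

theorem lintegral_localTime_le {Λ : Finset (Fin d → ℤ)} {θ : ℝ} (hθ : 0 < θ) (x : Fin d → ℤ)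
    (hmom : ∀ h, ∫⁻ ω, ENNReal.ofReal (Real.exp θ) ^
      count Prod.fst (visitWeight Λ) h (some 0) [] x ω ∂law d μ hμ ≤ 2) :
    ∫⁻ ω, localTime ω x Λ ∂law d μ hμ ≤ 2 / ENNReal.ofReal θ := by
  have hθ0 : ENNReal.ofReal θ ≠ 0 := by simpa using hθ
  have hlim : ∀ ω : Sample d, localTime ω x Λ ≤ Filter.liminf
      (fun h => (count Prod.fst (visitWeight Λ) h (some 0) [] x ω : ℝ≥0∞)) Filter.atTop := by
    intro ω
    rw [localTime_eq_iSup, ← (tendsto_atTop_iSup (monotone_truncatedTime ω x Λ)).liminf_eq]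
    exact Filter.liminf_le_liminf (Filter.Eventually.of_forall fun h =>
      truncatedTime_le_count ω x Λ h)
  refine (lintegral_mono hlim).trans ((lintegral_liminf_le fun h =>
    measurable_pow_count Prod.fst (visitWeight Λ) h (some 0) [] x fun n => n).trans ?_)
  refine Filter.liminf_le_of_frequently_le' (Filter.Frequently.of_forall fun h => ?_)
  rw [ENNReal.le_div_iff_mul_le (Or.inl hθ0) (Or.inl ENNReal.ofReal_ne_top), ← lintegral_mul_const]
  · refine (lintegral_mono fun ω => ?_).trans (hmom h)
    generalize count Prod.fst (visitWeight Λ) h (some 0) [] x ω = n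
    rw [← ENNReal.ofReal_pow (Real.exp_pos _).le, ← Real.exp_nat_mul, ← ENNReal.ofReal_natCast,
      ← ENNReal.ofReal_mul (Nat.cast_nonneg n)]
    refine ENNReal.ofReal_le_ofReal ?_
    linarith [Real.add_one_le_exp (n * θ)]
  · exact measurable_pow_count Prod.fst (visitWeight Λ) h (some 0) [] x fun n => n

/-- The Green's function dominates a multiple of `P² G² 1_{y}`, where `P` and `G` are the transition
and the Green operator of the simple random walk: the walk moves along the spine, leaves it at a
vertex that comes before the special child, and continues along a line of descent of a critical
tree, on which the expected number of visits is that of a simple random walk. -/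
theorem le_green (μ : PMF ℕ) (hμ : IsCriticalOffspring μ) (x y : Fin d → ℤ) :
    (∑' c, specialLaw μ hμ c * c.2) * avg^[2] (potential (potential (Set.indicator {y} 1))) x ≤
      green d μ hμ x y := by
  set β := ∑' c, specialLaw μ hμ c * c.2
  set f : (Fin d → ℤ) → ℝ≥0∞ := Set.indicator {y} 1
  calc β * avg^[2] (potential (potential f)) x
      = avg (β • avg (potential (potential f))) x := by rw [avg_smul]; rfl
    _ ≤ avg (fun z => ⨆ h, meanSpine β f h z) x := avg_mono (potential_le_iSup_meanSpine β f) x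
    _ = ⨆ h, avg (meanSpine β f h) x := congrFun (avg_iSup_of_monotone (monotone_meanSpine β f)) x
    _ ≤ green d μ hμ x y := iSup_le fun h => (avg_meanSpine_le y h x).trans
        (lintegral_mono fun ω => count_le_visits_past ω x y (h + 1))

theorem le_greenSet (μ : PMF ℕ) (hμ : IsCriticalOffspring μ) (x : Fin d → ℤ)
    (Λ : Finset (Fin d → ℤ)) :
    (∑' c, specialLaw μ hμ c * c.2) * avg^[2] (potential (potential (Set.indicator Λ 1))) x ≤
      greenSet d μ hμ x Λ := by
  classical
  have hzero : ∀ n, avg^[n] (0 : (Fin d → ℤ) → ℝ≥0∞) = 0 := fun n => by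
    simpa using iterate_avg_smul n 0 (0 : (Fin d → ℤ) → ℝ≥0∞)
  have hpot : potential (0 : (Fin d → ℤ) → ℝ≥0∞) = 0 := by
    simpa using potential_smul 0 (0 : (Fin d → ℤ) → ℝ≥0∞)
  rw [greenSet]
  induction Λ using Finset.induction_on with
  | empty =>
    rw [Finset.coe_empty, Set.indicator_empty', hpot, hpot, hzero]
    simp
  | insert y Λ hy ih =>
    have : Set.indicator ((insert y Λ : Finset (Fin d → ℤ)) : Set (Fin d → ℤ))
        (1 : (Fin d → ℤ) → ℝ≥0∞) =
        Set.indicator {y} 1 + Set.indicator Λ 1 := by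
      rw [Finset.coe_insert, Set.insert_eq, Set.indicator_union_of_disjoint (by simpa using hy)]
      rfl
    rw [this, potential_add, potential_add, iterate_avg_add, Pi.add_apply, mul_add,
      Finset.sum_insert hy]
    exact add_le_add (le_green μ hμ x y) ih

/-- The past is part of the tree, so finiteness follows from the exponential moments for singletons,
which are bounded uniformly in the starting point. -/
theorem iSup_greenSet_lt_top {a b : (Fin d → ℤ) → ℝ≥0∞} {D : ℝ≥0∞} (hk : IsGreenKernel a b D)
    (hexp : HasExponentialMoment μ) (hμ : IsCriticalOffspring μ) (Λ : Finset (Fin d → ℤ)) :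
    ⨆ x, greenSet d μ hμ x Λ < ⊤ := by
  obtain ⟨ε, hε, hεt, hmom⟩ := exists_exponential_moment hk hexp hμ
  have hpoint : ∀ y : Fin d → ℤ, ∃ C : ℝ≥0∞, C ≠ ⊤ ∧ ∀ x, green d μ hμ x y ≤ C := by
    intro y
    set K := ⨆ x, conv a (conv a (Set.indicator (({y} : Finset (Fin d → ℤ)) : Set _) 1)) x
    have hKt : K ≠ ⊤ := hk.iSup_conv_ne_top {y}
    have hK0 : K ≠ 0 := (lt_of_lt_of_le (pow_ne_zero 2 hk.zero_ne_zero).bot_lt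
      (hk.sq_le_iSup_conv (Finset.singleton_nonempty y))).ne'
    have hdt : ε / K ≠ ⊤ := ENNReal.div_ne_top hεt hK0
    have hθ : 0 < (ε / K).toReal := ENNReal.toReal_pos (ENNReal.div_pos hε hKt).ne' hdt
    refine ⟨2 / ENNReal.ofReal (ε / K).toReal,
      ENNReal.div_ne_top (by simp) (by simpa using hθ), fun x => ?_⟩
    refine (lintegral_mono fun ω => visits_past_le_localTime ω x y).trans
      (lintegral_localTime_le hθ x fun h =>
        hmom {y} (Finset.singleton_nonempty y) _ hθ ?_ h x)
    rw [ENNReal.ofReal_toReal hdt]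
    exact (ENNReal.div_mul_cancel hK0 hKt).le
  choose C hC hgreen using hpoint
  refine lt_of_le_of_lt (iSup_le fun x => Finset.sum_le_sum fun y _ => hgreen y x) ?_
  exact (ENNReal.sum_ne_top.2 fun y _ => hC y).lt_top

/-- The supremum of `a ⋆ a ⋆ 1_Λ` is at most a constant times the supremum of `G(x, Λ)`. -/
theorem exists_iSup_conv_le_mul {a b : (Fin d → ℤ) → ℝ≥0∞} {D : ℝ≥0∞} (hk : IsGreenKernel a b D)
    (hμ : IsCriticalOffspring μ) :
    ∃ C : ℝ≥0∞, C ≠ ⊤ ∧ ∀ Λ : Finset (Fin d → ℤ),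
      ⨆ x, conv a (conv a (Set.indicator Λ 1)) x ≤ C * ⨆ x, greenSet d μ hμ x Λ := by
  -- The factor is truncated at `1` so that its inverse can be cancelled.
  set β := min 1 (∑' c, specialLaw μ hμ c * c.2) with hβ
  have hβ0 : β ≠ 0 := (lt_min one_pos (tsum_specialLaw_index_ne_zero hμ).bot_lt).ne'
  have hβt : β ≠ ⊤ := ne_top_of_le_ne_top ENNReal.one_ne_top (min_le_left _ _)
  have hbt := hk.tsum_charge_ne_top
  have hβi : β⁻¹ ≠ ⊤ := ENNReal.inv_ne_top.2 hβ0
  refine ⟨(∑' x, b x) ^ 2 * (((nearestNeighbours d).card : ℝ≥0∞) ^ 2 * β⁻¹),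
    by finiteness, fun Λ => (hk.iSup_conv_le _).trans ?_⟩
  rw [mul_assoc]
  gcongr
  refine iSup_le fun x => (le_mul_iterate_avg_two _ x).trans ?_
  rw [mul_assoc]
  gcongr
  refine le_trans ?_ (mul_le_mul_right (le_iSup (fun x => greenSet d μ hμ x Λ) x) β⁻¹)
  set X := avg^[2] (potential (potential (Set.indicator (Λ : Set (Fin d → ℤ)) 1))) x
  calc X = β⁻¹ * (β * X) := by rw [← mul_assoc, ENNReal.inv_mul_cancel hβ0 hβt, one_mul]
    _ ≤ β⁻¹ * greenSet d μ hμ x Λ := mul_le_mul_right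
        ((mul_le_mul_left (min_le_right _ _) _).trans (le_greenSet μ hμ x Λ)) _

end ExponentialMoments

end BRW

end

theorem mainTheorem6 (d : ℕ) [NeZero d] (hd : 5 ≤ d) (μ : PMF ℕ)
    (hμ : BRW.IsCriticalOffspring μ) (hexp : BRW.HasExponentialMoment μ) :
    ∃ c : ℝ, 0 < c ∧ ∀ t : ℝ, 0 < t → ∀ Λ : Finset (Fin d → ℤ), Λ.Nonempty →
      (0 < ⨆ x : Fin d → ℤ, BRW.greenSet d μ hμ x Λ) ∧
      (⨆ x : Fin d → ℤ, BRW.greenSet d μ hμ x Λ) < (⊤ : ENNReal) ∧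
      BRW.law d μ hμ {ω | ENNReal.ofReal t < BRW.localTime ω 0 Λ} ≤
        ENNReal.ofReal (2 * Real.exp
          (-c * (t / (⨆ x : Fin d → ℤ, BRW.greenSet d μ hμ x Λ).toReal))) := by
  obtain ⟨a, b, D, hk⟩ := BRW.exists_isGreenKernel hd
  obtain ⟨ε, hε, hεt, hmom⟩ := BRW.exists_exponential_moment hk hexp hμ
  obtain ⟨C, hC, hKM⟩ := BRW.exists_iSup_conv_le_mul hk hμ
  have hC1 : C + 1 ≠ ⊤ := by finiteness
  have hC0 : C + 1 ≠ 0 := by simp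
  have hct : ε / (C + 1) ≠ ⊤ := ENNReal.div_ne_top hεt hC0
  have hc : 0 < (ε / (C + 1)).toReal := ENNReal.toReal_pos (ENNReal.div_pos hε hC1).ne' hct
  refine ⟨(ε / (C + 1)).toReal, hc, fun t ht Λ hΛ => ?_⟩
  have hMt := BRW.iSup_greenSet_lt_top hk hexp hμ Λ
  have hK := hKM Λ
  have hK0 := lt_of_lt_of_le (pow_ne_zero 2 hk.zero_ne_zero).bot_lt (hk.sq_le_iSup_conv hΛ)
  generalize (⨆ x : Fin d → ℤ, BRW.greenSet d μ hμ x Λ) = M at *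
  have hM0 : 0 < M := by
    rw [pos_iff_ne_zero]
    rintro rfl
    rw [mul_zero] at hK
    exact absurd (hK0.trans_le hK) (lt_irrefl _)
  refine ⟨hM0, hMt, ?_⟩
  have hM : 0 < M.toReal := ENNReal.toReal_pos hM0.ne' hMt.ne
  have hθ : 0 < (ε / (C + 1)).toReal / M.toReal := div_pos hc hM
  have hθε : ENNReal.ofReal ((ε / (C + 1)).toReal / M.toReal) *
      (⨆ x, BRW.conv a (BRW.conv a (Set.indicator Λ 1)) x) ≤ ε := by
    rw [ENNReal.ofReal_div_of_pos hM, ENNReal.ofReal_toReal hct, ENNReal.ofReal_toReal hMt.ne]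
    calc ε / (C + 1) / M * (⨆ x, BRW.conv a (BRW.conv a (Set.indicator Λ 1)) x)
        ≤ ε / (C + 1) / M * ((C + 1) * M) := by
          gcongr
          exact hK.trans (by gcongr; exact le_self_add)
      _ = ε / (C + 1) / M * M * (C + 1) := by ring
      _ = ε := by
          rw [ENNReal.div_mul_cancel hM0.ne' hMt.ne, ENNReal.div_mul_cancel hC0 hC1]
  have h := BRW.law_localTime_gt_le hθ 0 (fun h => hmom Λ hΛ _ hθ hθε h 0) ht
  convert h using 4
  ring
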